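/- The following is provable in $\mathsf{RCA}_0$ (second order arithmetic with the basic axioms of arithmetic, $\Sigma^0_1$-induction and $\Delta^0_1$-comprehension); equivalently, it holds in every model of $\mathsf{RCA}_0$. A well order is a linear order (given by a set of natural numbers and a binary relation on it, not necessarily non-empty) that is well founded, i.e. has no infinite descending sequence. For a linear order $X$: - $\omega^X$ is the set of finite sequences $\langle x_0,\dots,x_{n-1}\rangle$ with $x_i\in X$ and $x_0\ge x_1\ge\dots\ge x_{n-1}$, ordered lexicographically (at the first position where two sequences differ, a proper initial segment being smaller). Put $\omega^{\langle 0,X\rangle}:=X$ and $\omega^{\langle n+1,X\rangle}:=\omega^{(\omega^{\langle n,X\rangle})}$. - $G(X)$, the value at $X$ of the Goodstein predilator, is the set of terms $\sigma=(1+X)^{\gamma_0}\cdot(1+\delta_0)+\dots+(1+X)^{\gamma_{n-1}}\cdot(1+\delta_{n-1})$ with $n\in\mathbb N$, $\gamma_i\in G(X)$, $\delta_i\in X$ and $\gamma_0>\dots>\gamma_{n-1}$. By simultaneous recursion, $\sigma<\tau$ for a second term $\tau=(1+X)^{\gamma'_0}\cdot(1+\delta'_0)+\dots+(1+X)^{\gamma'_{m-1}}\cdot(1+\delta'_{m-1})$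 if and only if either $\tau$ properly extends $\sigma$, or there is $i<\min(n,m)$ such that $\gamma_j=\gamma'_j$ and $\delta_j=\delta'_j$ for all $j<i$, and $\gamma_i<\gamma'_i$ or ($\gamma_i=\gamma'_i$ and $\delta_i<\delta'_i$). **Proposition.** Over $\mathsf{RCA}_0$, the following are equivalent: (a) $\mathsf{ACA}'_0$, i.e. for every well order $X$ and every $n\in\mathbb N$, the order $\omega^{\langle n,X\rangle}$ is well founded; (b) the Goodstein predilator is a dilator, i.e. for every well order $X$, $G(X)$ is a well order. -/

import Mathlib

universe u

namespace SOA

/-! ## Structures for the language of second order arithmetic, and the system RCA₀ -/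

/-- A structure for the two-sorted language `L₂` of second order arithmetic: a domain of numbers
with `0, 1, +, ·, <`, and a collection of sets of numbers over which the set variables range. -/
structure L2Structure where
  Num : Type u
  zero : Num
  one : Num
  add : Num → Num → Num
  mul : Num → Num → Num
  lt : Num → Num → Prop
  sets : Set (Set Num)

namespace L2Structure

variable (𝓜 : L2Structure.{u})

instance : Zero 𝓜.Num := ⟨𝓜.zero⟩
instance : One 𝓜.Num := ⟨𝓜.one⟩
instance : Add 𝓜.Num := ⟨𝓜.add⟩
instance : Mul 𝓜.Num := ⟨𝓜.mul⟩
instance : LT 𝓜.Num := ⟨𝓜.lt⟩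

end L2Structure

/-- Numerical terms of `L₂` in the number variables `0, …, n - 1`, with parameters from `𝓜`. -/
inductive Term (𝓜 : L2Structure.{u}) (n : ℕ) : Type u
  | var (i : Fin n) : Term 𝓜 n
  | param (a : 𝓜.Num) : Term 𝓜 n
  | zero : Term 𝓜 n
  | one : Term 𝓜 n
  | add (s t : Term 𝓜 n) : Term 𝓜 n
  | mul (s t : Term 𝓜 n) : Term 𝓜 n

/-- Value of a term under an assignment of its variables. -/
def Term.val {𝓜 : L2Structure.{u}} {n : ℕ} (v : Fin n → 𝓜.Num) : Term 𝓜 n → 𝓜.Num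
  | .var i => v i
  | .param a => a
  | .zero => 0
  | .one => 1
  | .add s t => s.val v + t.val v
  | .mul s t => s.val v * t.val v

/-- Bounded quantifier formulas (`Δ⁰₀`) of `L₂` in the free number variables `0, …, n - 1`,
with number and set parameters from `𝓜`. The bound of a quantifier does not contain the
quantified variable, which is variable `0` of the formula in its scope. -/
inductive BFormula (𝓜 : L2Structure.{u}) : ℕ → Type u
  | eq {n : ℕ} (s t : Term 𝓜 n) : BFormula 𝓜 n
  | lt {n : ℕ} (s t : Term 𝓜 n) : BFormula 𝓜 n
  | mem {n : ℕ} (t : Term 𝓜 n) (A : 𝓜.sets) : BFormula 𝓜 n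
  | not {n : ℕ} (φ : BFormula 𝓜 n) : BFormula 𝓜 n
  | and {n : ℕ} (φ ψ : BFormula 𝓜 n) : BFormula 𝓜 n
  | or {n : ℕ} (φ ψ : BFormula 𝓜 n) : BFormula 𝓜 n
  | ball {n : ℕ} (t : Term 𝓜 n) (φ : BFormula 𝓜 (n + 1)) : BFormula 𝓜 n
  | bex {n : ℕ} (t : Term 𝓜 n) (φ : BFormula 𝓜 (n + 1)) : BFormula 𝓜 n

/-- Truth of a bounded quantifier formula in `𝓜`. -/
def BFormula.Holds {𝓜 : L2Structure.{u}} : {n : ℕ} → BFormula 𝓜 n → (Fin n → 𝓜.Num) → Prop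
  | _, .eq s t, v => s.val v = t.val v
  | _, .lt s t, v => s.val v < t.val v
  | _, .mem t A, v => t.val v ∈ A.1
  | _, .not φ, v => ¬ φ.Holds v
  | _, .and φ ψ, v => φ.Holds v ∧ ψ.Holds v
  | _, .or φ ψ, v => φ.Holds v ∨ ψ.Holds v
  | _, .ball t φ, v => ∀ x, x < t.val v → φ.Holds (Matrix.vecCons x v)
  | _, .bex t φ, v => ∃ x, x < t.val v ∧ φ.Holds (Matrix.vecCons x v)

/-- `𝓜` is a model of `RCA₀`: the basic axioms, the scheme of `Σ⁰₁`-induction and the scheme of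
`Δ⁰₁`-comprehension. A `Σ⁰₁` formula with free variable `x` is `∃ y, θ(y, x)`, and a `Π⁰₁`
formula is `∀ y, θ(y, x)`, where `θ` is a bounded quantifier formula (with parameters). -/
structure L2Structure.IsModelRCA0 (𝓜 : L2Structure.{u}) : Prop where
  add_one_ne_zero : ∀ m : 𝓜.Num, m + 1 ≠ 0
  add_one_inj : ∀ m n : 𝓜.Num, m + 1 = n + 1 → m = n
  add_zero : ∀ m : 𝓜.Num, m + 0 = m
  add_add_one : ∀ m n : 𝓜.Num, m + (n + 1) = (m + n) + 1
  mul_zero : ∀ m : 𝓜.Num, m * 0 = 0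
  mul_add_one : ∀ m n : 𝓜.Num, m * (n + 1) = m * n + m
  not_lt_zero : ∀ m : 𝓜.Num, ¬ m < 0
  lt_add_one_iff : ∀ m n : 𝓜.Num, m < n + 1 ↔ m < n ∨ m = n
  sigma01_induction : ∀ θ : BFormula 𝓜 2,
    (∃ y, θ.Holds ![y, 0]) →
    (∀ x, (∃ y, θ.Holds ![y, x]) → ∃ y, θ.Holds ![y, x + 1]) →
    ∀ x, ∃ y, θ.Holds ![y, x]
  delta01_comprehension : ∀ θ η : BFormula 𝓜 2,
    (∀ x, (∃ y, θ.Holds ![y, x]) ↔ ∀ y, η.Holds ![y, x]) →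
    ∃ A ∈ 𝓜.sets, ∀ x, x ∈ A ↔ ∃ y, θ.Holds ![y, x]

/-! ## Coding inside a structure

Everything below only quantifies over the numbers and the sets of the structure, so each notion
is the interpretation in the structure of a formula of `L₂`. -/

namespace L2Structure

variable {𝓜 : L2Structure.{u}}

/-- The standard (injective) pairing `(i, j) = (i + j)² + i` of second order arithmetic. -/
def pair (i j : 𝓜.Num) : 𝓜.Num := (i + j) * (i + j) + i

/-- The code of the empty sequence. -/
def nil : 𝓜.Num := 0

/-- The code of the sequence with first entry `a` whose remaining entries are coded by `l`. -/
def cons (a l : 𝓜.Num) : 𝓜.Num := pair a l + 1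

variable (𝓜) in
/-- A domain with a strict relation on numbers; the orders considered in second order arithmetic
are those given by sets of the structure, see `codedOrder` and `towerLevel`. -/
structure OrderData where
  dom : 𝓜.Num → Prop
  lt : 𝓜.Num → 𝓜.Num → Prop

/-- The order with domain `D` and relation `{(x, y) | pair x y ∈ L}`. -/
def codedOrder (D L : Set 𝓜.Num) : OrderData 𝓜 where
  dom x := x ∈ D
  lt x y := pair x y ∈ L

namespace OrderData

/-- `X` is a (strict) linear order on its domain. -/
structure IsLinear (X : OrderData 𝓜) : Prop where
  dom_of_lt : ∀ x y, X.lt x y → X.dom x ∧ X.dom y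
  irrefl : ∀ x, ¬ X.lt x x
  trans : ∀ x y z, X.lt x y → X.lt y z → X.lt x z
  total : ∀ x y, X.dom x → X.dom y → X.lt x y ∨ x = y ∨ X.lt y x

/-- `X` is well founded in `𝓜`: no function `F : ℕ → X`, given by a set of the structure, is an
infinite descending sequence. -/
def IsWellFounded (X : OrderData 𝓜) : Prop :=
  ¬ ∃ F ∈ 𝓜.sets,
    (∀ i, ∃! x, pair i x ∈ F) ∧
    (∀ i x, pair i x ∈ F → X.dom x) ∧
    ∀ i x y, pair i x ∈ F → pair (i + 1) y ∈ F → X.lt y x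

/-- `X` is a well order in `𝓜`. -/
def IsWellOrder (X : OrderData 𝓜) : Prop := X.IsLinear ∧ X.IsWellFounded

/-- `Y` is `ω^X`: the elements are the (codes of) finite sequences
`⟨x₀, …, xₙ₋₁⟩` with `xᵢ ∈ X` and `x₀ ≥ x₁ ≥ ⋯ ≥ xₙ₋₁`, ordered lexicographically, a proper initial
segment being smaller. Both clauses are recursions on the code of a sequence. -/
structure IsOmegaPow (X Y : OrderData 𝓜) : Prop where
  dom_iff : ∀ s, Y.dom s ↔
    s = nil ∨ ∃ a l, s = cons a l ∧ X.dom a ∧ Y.dom l ∧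
      ∀ b m, l = cons b m → X.lt b a ∨ b = a
  lt_iff : ∀ s t, Y.lt s t ↔
    Y.dom s ∧ Y.dom t ∧
      ((s = nil ∧ t ≠ nil) ∨
        ∃ a l b m, s = cons a l ∧ t = cons b m ∧ (X.lt a b ∨ (a = b ∧ Y.lt l m)))

/-- `Y` is the value `G(X)` of the Goodstein predilator. A term
`(1+X)^γ₀ · (1+δ₀) + ⋯ + (1+X)^γₙ₋₁ · (1+δₙ₋₁)` with `γᵢ ∈ G(X)`, `δᵢ ∈ X` and `γ₀ > ⋯ > γₙ₋₁`
is coded by the sequence of the pairs `(γᵢ, δᵢ)`. Terms are compared at the first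
pair where they differ, first by the exponents `γ` and then by the coefficients `δ`; a proper
initial segment is smaller. The clauses are a simultaneous recursion on codes. -/
structure IsGoodstein (X Y : OrderData 𝓜) : Prop where
  dom_iff : ∀ σ, Y.dom σ ↔
    σ = nil ∨ ∃ γ δ ρ, σ = cons (pair γ δ) ρ ∧ Y.dom γ ∧ X.dom δ ∧ Y.dom ρ ∧
      ∀ γ' δ' ρ', ρ = cons (pair γ' δ') ρ' → Y.lt γ' γ
  lt_iff : ∀ σ τ, Y.lt σ τ ↔
    Y.dom σ ∧ Y.dom τ ∧
      ((σ = nil ∧ τ ≠ nil) ∨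
        ∃ γ δ ρ γ' δ' ρ', σ = cons (pair γ δ) ρ ∧ τ = cons (pair γ' δ') ρ' ∧
          (Y.lt γ γ' ∨ (γ = γ' ∧ (X.lt δ δ' ∨ (δ = δ' ∧ Y.lt ρ ρ')))))

end OrderData

/-- The `n`-th order of the sequence of orders coded by `T` and `R`. -/
def towerLevel (T R : Set 𝓜.Num) (n : 𝓜.Num) : OrderData 𝓜 where
  dom x := pair n x ∈ T
  lt x y := pair n (pair x y) ∈ R

/-- The sets `T` and `R` code the sequence of the orders `ω^⟨n, X⟩`, for all numbers `n` of the
structure: `ω^⟨0, X⟩ = X` and `ω^⟨n+1, X⟩ = ω^(ω^⟨n, X⟩)`. -/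
structure IsTower (X : OrderData 𝓜) (T R : Set 𝓜.Num) : Prop where
  dom_zero : ∀ x, (towerLevel T R 0).dom x ↔ X.dom x
  lt_zero : ∀ x y, (towerLevel T R 0).lt x y ↔ X.lt x y
  succ : ∀ n, (towerLevel T R n).IsOmegaPow (towerLevel T R (n + 1))

variable (𝓜) in
/-- The characteristic axiom of `ACA'₀` over `RCA₀`: for every well order `X` and every number `n`,
the order `ω^⟨n, X⟩` (exists and) is well founded. -/
def ACAPrime : Prop :=
  ∀ D ∈ 𝓜.sets, ∀ L ∈ 𝓜.sets, (codedOrder D L).IsWellOrder →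
    (∃ T ∈ 𝓜.sets, ∃ R ∈ 𝓜.sets, IsTower (codedOrder D L) T R) ∧
    ∀ T ∈ 𝓜.sets, ∀ R ∈ 𝓜.sets, IsTower (codedOrder D L) T R →
      ∀ n, (towerLevel T R n).IsWellFounded

variable (𝓜) in
/-- The Goodstein predilator is a dilator, i.e. it preserves well orders: for every well order `X`,
the order `G(X)` (exists and) is a well order. -/
def GoodsteinIsDilator : Prop :=
  ∀ D ∈ 𝓜.sets, ∀ L ∈ 𝓜.sets, (codedOrder D L).IsWellOrder →
    (∃ E ∈ 𝓜.sets, ∃ K ∈ 𝓜.sets, (codedOrder D L).IsGoodstein (codedOrder E K)) ∧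
    ∀ E ∈ 𝓜.sets, ∀ K ∈ 𝓜.sets, (codedOrder D L).IsGoodstein (codedOrder E K) →
      (codedOrder E K).IsWellOrder

end L2Structure

end SOA

/-! Both directions build an order embedding inside the model and push a descending sequence through
it.

From (b) to (a): `ω^⟨n, X⟩` embeds into `G(ω + X)`. An element of `X` becomes a constant term, and a
non-increasing sequence becomes a term whose exponents are the images of its distinct entries. The
summand `ω` supplies coefficients that count repetitions, so the exponents become strictly
decreasing. The key lemma is `IsTowerMap.strictMono`; since `ω + X` is again a well order, (b)
applies to it.

From (a) to (b): terms of `G(X)` with exponents nested at most `n` deep embed into `ω^⟨2n, X + 1⟩`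
(`IsTermMap.strictMono`). Each nesting costs two exponentials, one to code the pair of exponent and
coefficient as a sequence of length two, the other to list these pairs. A smaller term is never
higher (`IsHeight.mem_of_lt`), and the height of a term is at most its code (`IsHeight.mem_of_le`).
Hence a descending sequence stays within the height of its first term, so a single `n` suffices,
possibly a nonstandard one.

All of this must be carried out in `RCA₀`. The orders and the graphs of the embeddings are defined
by course of values recursion (`exists_rel_recursion`), which rests on coding finite sets by
divisibility, as with Gödel's β-function. Totality of the maps is a matter of `Σ⁰₁`-induction,
uniqueness and monotonicity of `Π⁰₁`-induction. The typeclasses `Delta0`, `Sigma1` and `Pi1` record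
that the induction and comprehension formulas have the required complexity. -/

set_option synthInstance.maxSize 100000
set_option synthInstance.maxHeartbeats 400000
set_option linter.unusedSectionVars false

namespace SOA

open L2Structure

/-! ## Definability -/

section Definability

variable {𝓜 : L2Structure.{u}}

/-- The function `t` is the value of a term. -/
class TermDef {n : ℕ} (t : (Fin n → 𝓜.Num) → 𝓜.Num) : Prop where
  out : ∃ s : Term 𝓜 n, ∀ v, s.val v = t v

/-- The predicate `P` is defined by a bounded quantifier formula. -/
class Delta0 {n : ℕ} (P : (Fin n → 𝓜.Num) → Prop) : Prop where
  out : ∃ φ : BFormula 𝓜 n, ∀ v, φ.Holds v ↔ P v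

instance TermDef.const {n : ℕ} (a : 𝓜.Num) : TermDef (fun _ : Fin n → 𝓜.Num => a) :=
  ⟨.param a, fun _ => rfl⟩

instance TermDef.var {n : ℕ} (i : Fin n) : TermDef (fun v : Fin n → 𝓜.Num => v i) :=
  ⟨.var i, fun _ => rfl⟩

instance TermDef.add {n : ℕ} (s t : (Fin n → 𝓜.Num) → 𝓜.Num) [hs : TermDef s] [ht : TermDef t] :
    TermDef (fun v => s v + t v) := by
  obtain ⟨s', hs⟩ := hs.out
  obtain ⟨t', ht⟩ := ht.out
  exact ⟨.add s' t', fun v => by simp only [Term.val, hs, ht]⟩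

instance TermDef.mul {n : ℕ} (s t : (Fin n → 𝓜.Num) → 𝓜.Num) [hs : TermDef s] [ht : TermDef t] :
    TermDef (fun v => s v * t v) := by
  obtain ⟨s', hs⟩ := hs.out
  obtain ⟨t', ht⟩ := ht.out
  exact ⟨.mul s' t', fun v => by simp only [Term.val, hs, ht]⟩

instance TermDef.pair {n : ℕ} (s t : (Fin n → 𝓜.Num) → 𝓜.Num) [TermDef s] [TermDef t] :
    TermDef (fun v => pair (s v) (t v)) := by
  unfold L2Structure.pair; infer_instance

instance TermDef.cons {n : ℕ} (s t : (Fin n → 𝓜.Num) → 𝓜.Num) [TermDef s] [TermDef t] :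
    TermDef (fun v => cons (s v) (t v)) := by
  unfold L2Structure.cons; infer_instance

/-- A condition that does not involve the variables has a fixed truth value, so it is defined by `0
= 0` or by its negation. -/
instance Delta0.const {n : ℕ} (p : Prop) : Delta0 (fun _ : Fin n → 𝓜.Num => p) := by
  by_cases h : p
  · exact ⟨.eq .zero .zero, fun _ => by simp [BFormula.Holds, h]⟩
  · exact ⟨.not (.eq .zero .zero), fun _ => by simp [BFormula.Holds, h]⟩

instance Delta0.eq {n : ℕ} (s t : (Fin n → 𝓜.Num) → 𝓜.Num) [hs : TermDef s] [ht : TermDef t] :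
    Delta0 (fun v => s v = t v) := by
  obtain ⟨s', hs⟩ := hs.out
  obtain ⟨t', ht⟩ := ht.out
  exact ⟨.eq s' t', fun v => by simp only [BFormula.Holds, hs, ht]⟩

instance Delta0.lt {n : ℕ} (s t : (Fin n → 𝓜.Num) → 𝓜.Num) [hs : TermDef s] [ht : TermDef t] :
    Delta0 (fun v => s v < t v) := by
  obtain ⟨s', hs⟩ := hs.out
  obtain ⟨t', ht⟩ := ht.out
  exact ⟨.lt s' t', fun v => by simp only [BFormula.Holds, hs, ht]⟩

instance Delta0.mem {n : ℕ} (t : (Fin n → 𝓜.Num) → 𝓜.Num) [ht : TermDef t] (A : 𝓜.sets) :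
    Delta0 (fun v => t v ∈ (A : Set 𝓜.Num)) := by
  obtain ⟨t', ht⟩ := ht.out
  exact ⟨.mem t' A, fun v => by simp only [BFormula.Holds, ht]⟩

instance Delta0.not {n : ℕ} (P : (Fin n → 𝓜.Num) → Prop) [hP : Delta0 P] :
    Delta0 (fun v => ¬ P v) := by
  obtain ⟨φ, hφ⟩ := hP.out
  exact ⟨.not φ, fun v => by simp only [BFormula.Holds, hφ]⟩

instance Delta0.and {n : ℕ} (P Q : (Fin n → 𝓜.Num) → Prop) [hP : Delta0 P] [hQ : Delta0 Q] :
    Delta0 (fun v => P v ∧ Q v) := by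
  obtain ⟨φ, hφ⟩ := hP.out
  obtain ⟨ψ, hψ⟩ := hQ.out
  exact ⟨.and φ ψ, fun v => by simp only [BFormula.Holds, hφ, hψ]⟩

instance Delta0.or {n : ℕ} (P Q : (Fin n → 𝓜.Num) → Prop) [hP : Delta0 P] [hQ : Delta0 Q] :
    Delta0 (fun v => P v ∨ Q v) := by
  obtain ⟨φ, hφ⟩ := hP.out
  obtain ⟨ψ, hψ⟩ := hQ.out
  exact ⟨.or φ ψ, fun v => by simp only [BFormula.Holds, hφ, hψ]⟩

instance Delta0.imp {n : ℕ} (P Q : (Fin n → 𝓜.Num) → Prop) [hP : Delta0 P] [hQ : Delta0 Q] :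
    Delta0 (fun v => P v → Q v) := by
  simp only [imp_iff_not_or]; infer_instance

instance Delta0.iff {n : ℕ} (P Q : (Fin n → 𝓜.Num) → Prop) [hP : Delta0 P] [hQ : Delta0 Q] :
    Delta0 (fun v => P v ↔ Q v) := by
  simp only [iff_def]; infer_instance

instance Delta0.bex {n : ℕ} (t : (Fin n → 𝓜.Num) → 𝓜.Num) (P : 𝓜.Num → (Fin n → 𝓜.Num) → Prop)
    [ht : TermDef t] [hP : Delta0 (fun w : Fin (n + 1) → 𝓜.Num => P (w 0) (fun i => w i.succ))] :
    Delta0 (fun v => ∃ x, x < t v ∧ P x v) := by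
  obtain ⟨t', ht⟩ := ht.out
  obtain ⟨φ, hφ⟩ := hP.out
  exact ⟨.bex t' φ, fun v => by simp [BFormula.Holds, ht, hφ]⟩

instance Delta0.ball {n : ℕ} (t : (Fin n → 𝓜.Num) → 𝓜.Num) (P : 𝓜.Num → (Fin n → 𝓜.Num) → Prop)
    [ht : TermDef t] [hP : Delta0 (fun w : Fin (n + 1) → 𝓜.Num => P (w 0) (fun i => w i.succ))] :
    Delta0 (fun v => ∀ x, x < t v → P x v) := by
  obtain ⟨t', ht⟩ := ht.out
  obtain ⟨φ, hφ⟩ := hP.out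
  exact ⟨.ball t' φ, fun v => by simp [BFormula.Holds, ht, hφ]⟩

/-- The predicate `P` is defined by a `Σ⁰₁` formula. -/
class Sigma1 {n : ℕ} (P : (Fin n → 𝓜.Num) → Prop) : Prop where
  out : ∃ θ : BFormula 𝓜 (n + 1), ∀ v, P v ↔ ∃ y, θ.Holds (Matrix.vecCons y v)

/-- The predicate `P` is defined by a `Π⁰₁` formula. -/
class Pi1 {n : ℕ} (P : (Fin n → 𝓜.Num) → Prop) : Prop where
  out : Sigma1 (fun v => ¬ P v)

/-! ### Substitution of terms for variables -/

theorem TermDef.subst {n m : ℕ} {t : (Fin n → 𝓜.Num) → 𝓜.Num} (ht : TermDef t)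
    {σ : Fin n → (Fin m → 𝓜.Num) → 𝓜.Num} (hσ : ∀ i, TermDef (σ i)) :
    TermDef (fun w => t (fun i => σ i w)) := by
  obtain ⟨s, hs⟩ := ht.out
  simp only [← hs]
  clear hs
  induction s with
  | var i => exact hσ i
  | param a => exact TermDef.const a
  | zero => exact TermDef.const 0
  | one => exact TermDef.const 1
  | add s t hs ht => exact TermDef.add _ _
  | mul s t hs ht => exact TermDef.mul _ _

theorem Delta0.subst {n m : ℕ} {P : (Fin n → 𝓜.Num) → Prop} (hP : Delta0 P)
    {σ : Fin n → (Fin m → 𝓜.Num) → 𝓜.Num} (hσ : ∀ i, TermDef (σ i)) :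
    Delta0 (fun w => P (fun i => σ i w)) := by
  have term : ∀ {n m : ℕ} (s : Term 𝓜 n) {σ : Fin n → (Fin m → 𝓜.Num) → 𝓜.Num}
      (_ : ∀ i, TermDef (σ i)), TermDef (fun w => s.val (fun i => σ i w)) :=
    fun s σ hσ => TermDef.subst (t := fun v => s.val v) ⟨s, fun _ => rfl⟩ hσ
  -- Below a quantifier the substitution fixes the bound variable `0` and shifts the variables of
  -- the substituted terms by one.
  have lift : ∀ {n m : ℕ} {σ : Fin n → (Fin m → 𝓜.Num) → 𝓜.Num} (_ : ∀ i, TermDef (σ i))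
      (φ : BFormula 𝓜 (n + 1)), (∀ {m : ℕ} {τ : Fin (n + 1) → (Fin m → 𝓜.Num) → 𝓜.Num}
      (_ : ∀ i, TermDef (τ i)), Delta0 (fun w => φ.Holds (fun i => τ i w))) →
      Delta0 (fun w : Fin (m + 1) → 𝓜.Num =>
        φ.Holds (Matrix.vecCons (w 0) (fun i => σ i (fun j => w j.succ)))) := by
    intro n m σ hσ φ h
    have e : ∀ w : Fin (m + 1) → 𝓜.Num,
        Matrix.vecCons (w 0) (fun i => σ i (fun j => w j.succ)) = fun i =>
          (Fin.cons (fun w => w 0) (fun i w => σ i (fun j => w j.succ)) :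
            Fin (n + 1) → (Fin (m + 1) → 𝓜.Num) → 𝓜.Num) i w := by
      intro w
      funext i
      refine Fin.cases ?_ (fun j => ?_) i <;> rfl
    simp only [e]
    refine h fun i => Fin.cases ?_ (fun j => ?_) i
    · exact TermDef.var 0
    · exact (hσ j).subst fun i => TermDef.var i.succ
  obtain ⟨φ, hφ⟩ := hP.out
  simp only [← hφ]
  clear hφ hP P
  induction φ generalizing m with
  | eq s t =>
    have := term s hσ
    have := term t hσ
    exact Delta0.eq _ _
  | lt s t =>
    have := term s hσ
    have := term t hσ
    exact Delta0.lt _ _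
  | mem t A =>
    have := term t hσ
    exact Delta0.mem _ A
  | not φ ih => exact Delta0.not _ (hP := ih hσ)
  | and φ ψ ih1 ih2 => exact Delta0.and _ _ (hP := ih1 hσ) (hQ := ih2 hσ)
  | or φ ψ ih1 ih2 => exact Delta0.or _ _ (hP := ih1 hσ) (hQ := ih2 hσ)
  | ball t φ ih => exact @Delta0.ball _ _ _ _ (term t hσ) (lift hσ φ ih)
  | bex t φ ih => exact @Delta0.bex _ _ _ _ (term t hσ) (lift hσ φ ih)

theorem Delta0.reindex {n m : ℕ} {P : (Fin n → 𝓜.Num) → Prop} (hP : Delta0 P)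
    (f : Fin n → Fin m) : Delta0 (fun w : Fin m → 𝓜.Num => P (fun i => w (f i))) :=
  hP.subst fun i => TermDef.var (f i)

theorem Delta0.of_reindex {n m : ℕ} {Q : (Fin n → 𝓜.Num) → Prop} {P : (Fin m → 𝓜.Num) → Prop}
    (hQ : Delta0 Q) (f : Fin n → Fin m) (h : ∀ w, P w ↔ Q (fun i => w (f i))) : Delta0 P := by
  have : P = fun w => Q (fun i => w (f i)) := funext fun w => propext (h w)
  exact this ▸ hQ.reindex f

theorem Delta0.comp {n m : ℕ} {Q : 𝓜.Num → (Fin n → 𝓜.Num) → Prop}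
    (hQ : Delta0 (fun w : Fin (n + 1) → 𝓜.Num => Q (w 0) (fun i => w i.succ)))
    (j : Fin m) (f : Fin n → Fin m) :
    Delta0 (fun w : Fin m → 𝓜.Num => Q (w j) (fun i => w (f i))) := by
  simpa using hQ.reindex (Fin.cons j f : Fin (n + 1) → Fin m)

theorem Sigma1.of_exists {n : ℕ} {P : (Fin n → 𝓜.Num) → Prop} (Q : 𝓜.Num → (Fin n → 𝓜.Num) → Prop)
    (hQ : Delta0 (fun w : Fin (n + 1) → 𝓜.Num => Q (w 0) (fun i => w i.succ)))
    (h : ∀ v, P v ↔ ∃ y, Q y v) : Sigma1 P := by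
  obtain ⟨θ, hθ⟩ := hQ.out
  exact ⟨θ, fun v => by simp [h, hθ]⟩

theorem Sigma1.exists {n : ℕ} {P : (Fin n → 𝓜.Num) → Prop} (hP : Sigma1 P) :
    ∃ Q : 𝓜.Num → (Fin n → 𝓜.Num) → Prop,
      Delta0 (fun w : Fin (n + 1) → 𝓜.Num => Q (w 0) (fun i => w i.succ)) ∧
      ∀ v, P v ↔ ∃ y, Q y v := by
  obtain ⟨θ, hθ⟩ := hP.out
  refine ⟨fun y v => θ.Holds (Matrix.vecCons y v), ⟨θ, fun v => ?_⟩, hθ⟩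
  exact iff_of_eq (congrArg θ.Holds (Fin.cons_self_tail v).symm)

instance (priority := 2000) Delta0.sigma1 {n : ℕ} (P : (Fin n → 𝓜.Num) → Prop) [hP : Delta0 P] :
    Sigma1 P :=
  .of_exists (fun _ v => P v) (hP.reindex Fin.succ) (fun v => ⟨fun h => ⟨0, h⟩, fun ⟨_, h⟩ => h⟩)

instance (priority := 2000) Delta0.pi1 {n : ℕ} (P : (Fin n → 𝓜.Num) → Prop) [hP : Delta0 P] :
    Pi1 P := ⟨inferInstance⟩

end Definability

/-! ## Arithmetic -/

section Arithmetic

variable {𝓜 : L2Structure.{u}} [h𝓜 : Fact 𝓜.IsModelRCA0]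

theorem sigma1_induction {P : 𝓜.Num → Prop} (hP : Sigma1 (fun v : Fin 1 → 𝓜.Num => P (v 0)))
    (h0 : P 0) (h1 : ∀ x, P x → P (x + 1)) : ∀ x, P x := by
  obtain ⟨θ, hθ⟩ := hP.out
  have key : ∀ x, P x ↔ ∃ y, θ.Holds ![y, x] := fun x => hθ ![x]
  intro x
  rw [key]
  refine h𝓜.out.sigma01_induction θ ?_ ?_ x
  · rwa [← key]
  · intro x
    rw [← key, ← key]
    exact h1 x

@[elab_as_elim]
theorem delta0_induction {P : 𝓜.Num → Prop} [Delta0 (fun v : Fin 1 → 𝓜.Num => P (v 0))]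
    (h0 : P 0) (h1 : ∀ x, P x → P (x + 1)) (x : 𝓜.Num) : P x :=
  sigma1_induction inferInstance h0 h1 x

/-! ### The numbers form an ordered commutative semiring -/

namespace L2Structure.Num

theorem zero_add' (a : 𝓜.Num) : 0 + a = a := by
  refine delta0_induction (h𝓜.out.add_zero 0) ?_ a
  intro x h
  rw [h𝓜.out.add_add_one, h]

theorem add_assoc' (a b c : 𝓜.Num) : a + b + c = a + (b + c) := by
  refine delta0_induction ?_ ?_ c
  · rw [h𝓜.out.add_zero, h𝓜.out.add_zero]
  · intro x h
    rw [h𝓜.out.add_add_one, h𝓜.out.add_add_one, h𝓜.out.add_add_one, h]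

theorem one_add' (a : 𝓜.Num) : 1 + a = a + 1 := by
  refine delta0_induction ?_ ?_ a
  · rw [h𝓜.out.add_zero, zero_add']
  · intro x h
    rw [h𝓜.out.add_add_one, h]

theorem add_comm' (a b : 𝓜.Num) : a + b = b + a := by
  refine delta0_induction ?_ ?_ b
  · rw [h𝓜.out.add_zero, zero_add']
  · intro x h
    rw [h𝓜.out.add_add_one, h, add_assoc', add_assoc', one_add']

instance : AddCommMonoid 𝓜.Num where
  add_assoc := add_assoc'
  zero_add := zero_add'
  add_zero := h𝓜.out.add_zero
  add_comm := add_comm'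
  nsmul := nsmulRec

theorem mul_add_one' (a b : 𝓜.Num) : a * (b + 1) = a * b + a := h𝓜.out.mul_add_one a b

theorem mul_add' (a b c : 𝓜.Num) : a * (b + c) = a * b + a * c := by
  refine delta0_induction ?_ ?_ c
  · rw [h𝓜.out.mul_zero, add_zero, add_zero]
  · intro x h
    rw [← add_assoc, mul_add_one', mul_add_one', h, add_assoc]

theorem zero_mul' (a : 𝓜.Num) : 0 * a = 0 := by
  refine delta0_induction (h𝓜.out.mul_zero 0) ?_ a
  intro x h
  rw [mul_add_one', h, add_zero]

theorem add_one_mul' (a b : 𝓜.Num) : (a + 1) * b = a * b + b := by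
  refine delta0_induction ?_ ?_ b
  · rw [h𝓜.out.mul_zero, h𝓜.out.mul_zero, add_zero]
  · intro x h
    rw [mul_add_one', mul_add_one', h, add_assoc, add_assoc, ← add_assoc x, ← add_assoc a,
      add_comm x a]

theorem mul_comm' (a b : 𝓜.Num) : a * b = b * a := by
  refine delta0_induction ?_ ?_ b
  · rw [h𝓜.out.mul_zero, zero_mul']
  · intro x h
    rw [mul_add_one', add_one_mul', h]

theorem mul_assoc' (a b c : 𝓜.Num) : a * b * c = a * (b * c) := by
  refine delta0_induction ?_ ?_ c
  · rw [h𝓜.out.mul_zero, h𝓜.out.mul_zero, h𝓜.out.mul_zero]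
  · intro x h
    rw [mul_add_one', mul_add_one', mul_add', h]

theorem mul_one' (a : 𝓜.Num) : a * 1 = a := by
  have h := mul_add_one' a 0
  rwa [zero_add, h𝓜.out.mul_zero, zero_add] at h

instance : CommSemiring 𝓜.Num where
  left_distrib := mul_add'
  right_distrib a b c := by rw [mul_comm' (a + b) c, mul_add', mul_comm' c a, mul_comm' c b]
  zero_mul := zero_mul'
  mul_zero := h𝓜.out.mul_zero
  mul_assoc := mul_assoc'
  one_mul a := by rw [mul_comm', mul_one']
  mul_one := mul_one'
  mul_comm := mul_comm'

theorem lt_add_one_iff' {a b : 𝓜.Num} : a < b + 1 ↔ a < b ∨ a = b := h𝓜.out.lt_add_one_iff a b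

theorem lt_iff_exists' {a b : 𝓜.Num} : a < b ↔ ∃ c, b = a + c + 1 := by
  constructor
  -- With the existential quantifier in front of the implication, the induction formula is visibly
  -- `Σ⁰₁`.
  · have key : ∀ b : 𝓜.Num, ∃ c, a < b → b = a + c + 1 := by
      refine sigma1_induction (.of_exists (fun c v => a < v 0 → v 0 = a + c + 1)
        inferInstance fun _ => Iff.rfl) ?_ ?_
      · exact ⟨0, fun h => absurd h (h𝓜.out.not_lt_zero a)⟩
      · intro x ⟨c, hc⟩
        by_cases h : a < x
        · refine ⟨c + 1, fun _ => ?_⟩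
          rw [hc h, ← add_assoc]
        · refine ⟨0, fun h' => ?_⟩
          rcases lt_add_one_iff'.1 h' with h' | rfl
          · exact absurd h' h
          · rw [add_zero]
    obtain ⟨c, hc⟩ := key b
    exact fun h => ⟨c, hc h⟩
  · rintro ⟨c, rfl⟩
    refine delta0_induction ?_ ?_ c
    · rw [add_zero]
      exact lt_add_one_iff'.2 (Or.inr rfl)
    · intro x h
      rw [← add_assoc]
      exact lt_add_one_iff'.2 (Or.inl h)

theorem add_right_cancel' {a b c : 𝓜.Num} : a + c = b + c → a = b := by
  refine delta0_induction (P := fun c => a + c = b + c → a = b) ?_ ?_ c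
  · rw [add_zero, add_zero]; exact id
  · intro x h h'
    rw [← add_assoc, ← add_assoc] at h'
    exact h (h𝓜.out.add_one_inj _ _ h')

theorem lt_trans' {a b c : 𝓜.Num} (h1 : a < b) (h2 : b < c) : a < c := by
  obtain ⟨d, rfl⟩ := lt_iff_exists'.1 h1
  obtain ⟨e, rfl⟩ := lt_iff_exists'.1 h2
  exact lt_iff_exists'.2 ⟨d + 1 + e, by ring⟩

theorem lt_irrefl' (a : 𝓜.Num) : ¬ a < a := by
  intro h
  obtain ⟨d, hd⟩ := lt_iff_exists'.1 h
  have : 0 + a = (d + 1) + a := by rw [zero_add]; nth_rewrite 1 [hd]; ring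
  exact h𝓜.out.add_one_ne_zero d (add_right_cancel' this).symm

theorem zero_lt_add_one' (a : 𝓜.Num) : 0 < a + 1 :=
  lt_iff_exists'.2 ⟨a, by rw [zero_add]⟩

theorem lt_trichotomy' (a b : 𝓜.Num) : a < b ∨ a = b ∨ b < a := by
  refine delta0_induction (P := fun b => a < b ∨ a = b ∨ b < a) ?_ ?_ b
  · refine delta0_induction (P := fun a => a < 0 ∨ a = 0 ∨ 0 < a) (Or.inr (Or.inl rfl)) ?_ a
    exact fun x _ => Or.inr (Or.inr (zero_lt_add_one' x))
  · intro x h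
    rw [lt_add_one_iff']
    rcases h with h | h | h
    · exact Or.inl (Or.inl h)
    · exact Or.inl (Or.inr h)
    · obtain ⟨d, rfl⟩ := lt_iff_exists'.1 h
      refine Or.inr ?_
      -- The induction hypothesis is not used; this only separates the cases of zero and successor.
      refine delta0_induction (P := fun d => x + d + 1 = x + 1 ∨ x + 1 < x + d + 1) ?_ ?_ d
      · exact Or.inl (by rw [add_zero])
      · intro y _
        exact Or.inr (lt_iff_exists'.2 ⟨y, by ring⟩)

noncomputable instance : LinearOrder 𝓜.Num where
  le a b := a < b ∨ a = b
  lt := (· < ·)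
  le_refl a := Or.inr rfl
  le_trans a b c h1 h2 := by
    rcases h1 with h1 | rfl
    · rcases h2 with h2 | rfl
      · exact Or.inl (lt_trans' h1 h2)
      · exact Or.inl h1
    · exact h2
  lt_iff_le_not_ge a b := by
    constructor
    · intro h
      refine ⟨Or.inl h, ?_⟩
      rintro (h' | rfl)
      · exact lt_irrefl' _ (lt_trans' h h')
      · exact lt_irrefl' _ h
    · rintro ⟨h | rfl, h'⟩
      · exact h
      · exact absurd (Or.inr rfl) h'
  le_antisymm a b h1 h2 := by
    rcases h1 with h1 | h1
    · rcases h2 with h2 | h2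
      · exact absurd (lt_trans' h1 h2) (lt_irrefl' _)
      · exact h2.symm
    · exact h1
  le_total a b := by
    rcases lt_trichotomy' a b with h | h | h
    · exact Or.inl (Or.inl h)
    · exact Or.inl (Or.inr h)
    · exact Or.inr (Or.inl h)
  toDecidableLE := Classical.decRel _

instance : CanonicallyOrderedAdd 𝓜.Num where
  exists_add_of_le {a b} h := by
    rcases h with h | rfl
    · obtain ⟨c, hc⟩ := lt_iff_exists'.1 h
      exact ⟨c + 1, by rw [hc, add_assoc]⟩
    · exact ⟨0, (add_zero _).symm⟩
  le_self_add a b := by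
    rcases lt_trichotomy' 0 b with h | rfl | h
    · obtain ⟨c, rfl⟩ := lt_iff_exists'.1 h
      exact Or.inl (lt_iff_exists'.2 ⟨c, by ring⟩)
    · exact Or.inr (add_zero _).symm
    · exact absurd h (h𝓜.out.not_lt_zero b)
  le_add_self a b := by
    rcases lt_trichotomy' 0 b with h | rfl | h
    · obtain ⟨c, rfl⟩ := lt_iff_exists'.1 h
      exact Or.inl (lt_iff_exists'.2 ⟨c, by ring⟩)
    · exact Or.inr (zero_add _).symm
    · exact absurd h (h𝓜.out.not_lt_zero b)

instance : IsOrderedCancelAddMonoid 𝓜.Num where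
  add_le_add_left a b h c := by
    obtain ⟨d, rfl⟩ := exists_add_of_le h
    rw [add_right_comm]
    exact le_self_add
  le_of_add_le_add_left a b c h := by
    obtain ⟨d, hd⟩ := exists_add_of_le h
    rw [add_assoc, add_comm a c, add_comm a (b + d)] at hd
    rw [add_right_cancel' hd]
    exact le_self_add

instance : Nontrivial 𝓜.Num :=
  ⟨0, 1, fun h => h𝓜.out.add_one_ne_zero 0 (by rw [zero_add]; exact h.symm)⟩

instance : ZeroLEOneClass 𝓜.Num := ⟨zero_le⟩

noncomputable instance : SuccOrder 𝓜.Num :=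
  SuccOrder.ofSuccLeIff (fun a => a + 1) (fun {a b} => by
    constructor
    · intro h
      exact (lt_add_one_iff'.2 (Or.inr rfl)).trans_le h
    · intro h
      obtain ⟨c, rfl⟩ := lt_iff_exists'.1 h
      rw [add_right_comm]
      exact le_self_add)

noncomputable instance : SuccAddOrder 𝓜.Num := ⟨fun _ => rfl⟩

instance : IsStrictOrderedRing 𝓜.Num where
  mul_lt_mul_of_pos_left a ha b c h := by
    obtain ⟨d, rfl⟩ := lt_iff_exists'.1 h
    obtain ⟨e, rfl⟩ := lt_iff_exists'.1 ha
    exact lt_iff_exists'.2 ⟨d * (e + 1) + e, by ring⟩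
  mul_lt_mul_of_pos_right a ha b c h := by
    obtain ⟨d, rfl⟩ := lt_iff_exists'.1 h
    obtain ⟨e, rfl⟩ := lt_iff_exists'.1 ha
    exact lt_iff_exists'.2 ⟨d * (e + 1) + e, by ring⟩

end L2Structure.Num

end Arithmetic

/-! ## Closure of `Σ⁰₁` and `Π⁰₁`, induction and comprehension -/

section Closure

variable {𝓜 : L2Structure.{u}} [h𝓜 : Fact 𝓜.IsModelRCA0]

instance Delta0.le {n : ℕ} (s t : (Fin n → 𝓜.Num) → 𝓜.Num) [TermDef s] [TermDef t] :
    Delta0 (fun v => s v ≤ t v) := by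
  simp only [le_iff_lt_or_eq]; infer_instance

instance Delta0.ne {n : ℕ} (s t : (Fin n → 𝓜.Num) → 𝓜.Num) [TermDef s] [TermDef t] :
    Delta0 (fun v => s v ≠ t v) := by
  simp only [ne_eq]; infer_instance

instance Delta0.bex_le {n : ℕ} (t : (Fin n → 𝓜.Num) → 𝓜.Num)
    (P : 𝓜.Num → (Fin n → 𝓜.Num) → Prop)
    [TermDef t] [Delta0 (fun w : Fin (n + 1) → 𝓜.Num => P (w 0) (fun i => w i.succ))] :
    Delta0 (fun v => ∃ x, x ≤ t v ∧ P x v) := by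
  simp only [← Order.lt_add_one_iff]; infer_instance

instance Delta0.ball_le {n : ℕ} (t : (Fin n → 𝓜.Num) → 𝓜.Num)
    (P : 𝓜.Num → (Fin n → 𝓜.Num) → Prop)
    [TermDef t] [Delta0 (fun w : Fin (n + 1) → 𝓜.Num => P (w 0) (fun i => w i.succ))] :
    Delta0 (fun v => ∀ x, x ≤ t v → P x v) := by
  simp only [← Order.lt_add_one_iff]; infer_instance

/-- Two unbounded quantifiers are merged by quantifying over a common bound `b` for both witnesses.
-/
instance Sigma1.ex {n : ℕ} (P : 𝓜.Num → (Fin n → 𝓜.Num) → Prop)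
    [hP : Sigma1 (fun w : Fin (n + 1) → 𝓜.Num => P (w 0) (fun i => w i.succ))] :
    Sigma1 (fun v => ∃ x, P x v) := by
  obtain ⟨Q, hQ, h⟩ := hP.exists
  refine .of_exists (fun b v => ∃ x, x < b ∧ ∃ y, y < b ∧ Q y (Matrix.vecCons x v)) ?_ ?_
  · refine @Delta0.bex _ _ _ _ _ (@Delta0.bex _ _ _ _ inferInstance ?_)
    refine hQ.of_reindex (Fin.cons 0 (Fin.cons 1 fun i => i.succ.succ.succ)) fun w => ?_
    refine iff_of_eq (congrArg (Q (w 0)) (funext fun i => ?_))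
    refine Fin.cases ?_ (fun j => ?_) i <;> rfl
  · intro v
    constructor
    · rintro ⟨x, hx⟩
      obtain ⟨y, hy⟩ := (h (Matrix.vecCons x v)).1 (by simpa using hx)
      exact ⟨x + y + 1, x, Order.lt_add_one_iff.2 le_self_add, y,
        Order.lt_add_one_iff.2 le_add_self, hy⟩
    · rintro ⟨b, x, -, y, -, hy⟩
      exact ⟨x, by simpa using (h (Matrix.vecCons x v)).2 ⟨y, hy⟩⟩

instance Sigma1.and {n : ℕ} (P Q : (Fin n → 𝓜.Num) → Prop) [hP : Sigma1 P] [hQ : Sigma1 Q] :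
    Sigma1 (fun v => P v ∧ Q v) := by
  obtain ⟨P', hP', h1⟩ := hP.exists
  obtain ⟨Q', hQ', h2⟩ := hQ.exists
  have : (fun v => P v ∧ Q v) = (fun v => ∃ x y, P' x v ∧ Q' y v) := by
    funext v
    rw [h1, h2]
    simp
  rw [this]
  have h3 := hP'.comp (1 : Fin (n + 2)) (fun i => i.succ.succ)
  have h4 := hQ'.comp (0 : Fin (n + 2)) (fun i => i.succ.succ)
  have h5 := Delta0.and _ _ (hP := h3) (hQ := h4)
  exact @Sigma1.ex _ _ _ _ (@Sigma1.ex _ _ _ _ (@Delta0.sigma1 _ _ _ h5))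

instance Sigma1.or {n : ℕ} (P Q : (Fin n → 𝓜.Num) → Prop) [hP : Sigma1 P] [hQ : Sigma1 Q] :
    Sigma1 (fun v => P v ∨ Q v) := by
  obtain ⟨P', hP', h1⟩ := hP.exists
  obtain ⟨Q', hQ', h2⟩ := hQ.exists
  refine .of_exists (fun y v => P' y v ∨ Q' y v) inferInstance fun v => ?_
  rw [h1, h2, exists_or]

/-- `Σ⁰₁` collection. -/
theorem exists_bound {P : 𝓜.Num → 𝓜.Num → Prop}
    (hP : Delta0 (fun v : Fin 2 → 𝓜.Num => P (v 0) (v 1))) (t : 𝓜.Num)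
    (h : ∀ x < t, ∃ y, P y x) : ∃ b, ∀ x < t, ∃ y < b, P y x := by
  -- The induction is on the length `s` of the initial segment already bounded. The guard `s ≤ t`
  -- keeps it in the range of `h`; beyond `t` any `b` will do.
  have key : ∀ s, ∃ b, s ≤ t → ∀ x < s, ∃ y < b, P y x := by
    refine sigma1_induction (.of_exists (fun b v => v 0 ≤ t → ∀ x < v 0, ∃ y < b, P y x)
        ?_ fun _ => Iff.rfl) ?_ ?_
    · refine @Delta0.imp _ _ _ _ inferInstance (@Delta0.ball _ _ _ _ inferInstance
        (@Delta0.bex _ _ _ _ inferInstance ?_))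
      exact hP.reindex ![0, 1]
    · exact ⟨0, fun _ x hx => absurd hx not_lt_zero⟩
    · rintro s ⟨b, hb⟩
      by_cases hs : s < t
      · obtain ⟨y, hy⟩ := h s hs
        refine ⟨b + y + 1, fun _ x hx => ?_⟩
        rcases (Order.lt_add_one_iff.1 hx).lt_or_eq with hx | rfl
        · obtain ⟨z, hz, hz'⟩ := hb hs.le x hx
          exact ⟨z, hz.trans_le (le_self_add.trans le_self_add), hz'⟩
        · exact ⟨y, Order.lt_add_one_iff.2 le_add_self, hy⟩
      · exact ⟨0, fun h' => absurd (Order.add_one_le_iff.1 h') hs⟩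
  obtain ⟨b, hb⟩ := key t
  exact ⟨b, hb le_rfl⟩

/-- Collection replaces the witnesses for all `x` below the bound by a single bound on them, which
moves the unbounded quantifier to the front. -/
instance Sigma1.ball {n : ℕ} (t : (Fin n → 𝓜.Num) → 𝓜.Num) (P : 𝓜.Num → (Fin n → 𝓜.Num) → Prop)
    [ht : TermDef t] [hP : Sigma1 (fun w : Fin (n + 1) → 𝓜.Num => P (w 0) (fun i => w i.succ))] :
    Sigma1 (fun v => ∀ x, x < t v → P x v) := by
  obtain ⟨Q, hQ, h⟩ := hP.exists
  have h' : ∀ v x, P x v ↔ ∃ y, Q y (Matrix.vecCons x v) := by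
    intro v x
    rw [← h]
    simp
  refine .of_exists (fun b v => ∀ x, x < t v → ∃ y, y < b ∧ Q y (Matrix.vecCons x v)) ?_ ?_
  · refine @Delta0.ball _ _ _ _ (ht.subst fun i => TermDef.var i.succ) (@Delta0.bex _ _ _ _ inferInstance ?_)
    refine hQ.of_reindex (Fin.cons 0 (Fin.cons 1 fun i => i.succ.succ.succ)) fun w => ?_
    refine iff_of_eq (congrArg (Q (w 0)) (funext fun i => ?_))
    refine Fin.cases ?_ (fun j => ?_) i <;> rfl
  · intro v
    simp only [h']
    constructor
    · refine exists_bound (P := fun y x => Q y (Matrix.vecCons x v)) ?_ _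
      -- Collection concerns only the two variables `y` and `x`; the entries of `v` are treated as
      -- parameters.
      have hσ : ∀ i : Fin (n + 2), TermDef (fun w : Fin 2 → 𝓜.Num =>
          (Fin.cons (w 0) (Fin.cons (w 1) v) : Fin (n + 2) → 𝓜.Num) i) := by
        intro i
        refine Fin.cases ?_ (fun j => Fin.cases ?_ (fun k => ?_) j) i <;>
          simp only [Fin.cons_zero, Fin.cons_succ] <;> infer_instance
      exact hQ.subst hσ
    · rintro ⟨b, hb⟩ x hx
      obtain ⟨y, -, hy⟩ := hb x hx
      exact ⟨y, hy⟩

instance Sigma1.ball_le {n : ℕ} (t : (Fin n → 𝓜.Num) → 𝓜.Num)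
    (P : 𝓜.Num → (Fin n → 𝓜.Num) → Prop)
    [TermDef t] [Sigma1 (fun w : Fin (n + 1) → 𝓜.Num => P (w 0) (fun i => w i.succ))] :
    Sigma1 (fun v => ∀ x, x ≤ t v → P x v) := by
  simp only [← Order.lt_add_one_iff]; infer_instance

instance Sigma1.not {n : ℕ} (P : (Fin n → 𝓜.Num) → Prop) [hP : Pi1 P] :
    Sigma1 (fun v => ¬ P v) := hP.out

instance Sigma1.imp {n : ℕ} (P Q : (Fin n → 𝓜.Num) → Prop) [hP : Pi1 P] [hQ : Sigma1 Q] :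
    Sigma1 (fun v => P v → Q v) := by
  simp only [imp_iff_not_or]; infer_instance

instance Pi1.not {n : ℕ} (P : (Fin n → 𝓜.Num) → Prop) [hP : Sigma1 P] :
    Pi1 (fun v => ¬ P v) := ⟨by simpa only [not_not]⟩

instance Pi1.and {n : ℕ} (P Q : (Fin n → 𝓜.Num) → Prop) [hP : Pi1 P] [hQ : Pi1 Q] :
    Pi1 (fun v => P v ∧ Q v) := ⟨by simp only [not_and_or]; infer_instance⟩

instance Pi1.or {n : ℕ} (P Q : (Fin n → 𝓜.Num) → Prop) [hP : Pi1 P] [hQ : Pi1 Q] :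
    Pi1 (fun v => P v ∨ Q v) := ⟨by simp only [not_or]; infer_instance⟩

instance Pi1.imp {n : ℕ} (P Q : (Fin n → 𝓜.Num) → Prop) [hP : Sigma1 P] [hQ : Pi1 Q] :
    Pi1 (fun v => P v → Q v) := by
  simp only [imp_iff_not_or]; infer_instance

instance Pi1.all {n : ℕ} (P : 𝓜.Num → (Fin n → 𝓜.Num) → Prop)
    [hP : Pi1 (fun w : Fin (n + 1) → 𝓜.Num => P (w 0) (fun i => w i.succ))] :
    Pi1 (fun v => ∀ x, P x v) := ⟨by
  have := hP.out
  simp only [not_forall]; infer_instance⟩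

theorem Sigma1.subst {n m : ℕ} {P : (Fin n → 𝓜.Num) → Prop} (hP : Sigma1 P)
    {σ : Fin n → (Fin m → 𝓜.Num) → 𝓜.Num} (hσ : ∀ i, TermDef (σ i)) :
    Sigma1 (fun w => P (fun i => σ i w)) := by
  obtain ⟨Q, hQ, hQ'⟩ := hP.exists
  refine .of_exists (fun y w => Q y (fun i => σ i w)) ?_ fun w => hQ' fun i => σ i w
  have hτ : ∀ i : Fin (n + 1), TermDef (fun w : Fin (m + 1) → 𝓜.Num =>
      (Fin.cons (w 0) (fun i => σ i fun j => w j.succ) : Fin (n + 1) → 𝓜.Num) i) := by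
    intro i
    refine Fin.cases ?_ (fun j => ?_) i <;> simp only [Fin.cons_zero, Fin.cons_succ]
    · infer_instance
    · exact (hσ j).subst fun i => TermDef.var i.succ
  exact hQ.subst hτ

theorem Sigma1.comp {n : ℕ} {P : 𝓜.Num → Prop} (hP : Sigma1 (fun v : Fin 1 → 𝓜.Num => P (v 0)))
    (t : (Fin n → 𝓜.Num) → 𝓜.Num) [ht : TermDef t] : Sigma1 (fun v => P (t v)) :=
  hP.subst (σ := fun _ => t) fun _ => ht

instance Pi1.bex {n : ℕ} (t : (Fin n → 𝓜.Num) → 𝓜.Num) (P : 𝓜.Num → (Fin n → 𝓜.Num) → Prop)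
    [ht : TermDef t] [hP : Pi1 (fun w : Fin (n + 1) → 𝓜.Num => P (w 0) (fun i => w i.succ))] :
    Pi1 (fun v => ∃ x, x < t v ∧ P x v) := ⟨by
  have := hP.out
  simp only [not_exists, not_and]; infer_instance⟩

instance Pi1.bex_le {n : ℕ} (t : (Fin n → 𝓜.Num) → 𝓜.Num) (P : 𝓜.Num → (Fin n → 𝓜.Num) → Prop)
    [TermDef t] [Pi1 (fun w : Fin (n + 1) → 𝓜.Num => P (w 0) (fun i => w i.succ))] :
    Pi1 (fun v => ∃ x, x ≤ t v ∧ P x v) := by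
  simp only [← Order.lt_add_one_iff]; infer_instance

@[elab_as_elim]
theorem sigma1_strong_induction {P : 𝓜.Num → Prop}
    [hP : Sigma1 (fun v : Fin 1 → 𝓜.Num => P (v 0))] (h : ∀ x, (∀ y < x, P y) → P x) (x : 𝓜.Num) :
    P x := by
  have key : ∀ x, ∀ y < x, P y := by
    refine sigma1_induction ?_ (fun y hy => absurd hy not_lt_zero) ?_
    · exact Sigma1.ball _ _ (ht := inferInstance)
        (hP := hP.comp (fun w : Fin 2 → 𝓜.Num => w 0))
    · intro x ih y hy
      rcases (Order.lt_add_one_iff.1 hy).lt_or_eq with hy | rfl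
      · exact ih y hy
      · exact h y ih
  exact h x (key x)

@[elab_as_elim]
-- A failure at `a` is moved downwards: by `Σ⁰₁`-induction on `x` there is a counterexample `y = a -
-- x` for each `x ≤ a`. At `x = a` this contradicts `h0`.
theorem pi1_induction {P : 𝓜.Num → Prop} [hP : Pi1 (fun v : Fin 1 → 𝓜.Num => P (v 0))]
    (h0 : P 0) (h1 : ∀ x, P x → P (x + 1)) (a : 𝓜.Num) : P a := by
  by_contra ha
  have key : ∀ x, ∃ y, (x ≤ a → y + x = a) ∧ ¬ P y := by
    refine sigma1_induction ?_ ⟨a, fun _ => add_zero a, ha⟩ ?_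
    · have := Sigma1.comp (P := fun y => ¬ P y) hP.out (fun w : Fin 2 → 𝓜.Num => w 0)
      refine Sigma1.ex _ (hP := Sigma1.and _ _ (hP := inferInstance) (hQ := this))
    · rintro x ⟨y, hy, hy'⟩
      by_cases hx : x + 1 ≤ a
      · have e := hy (le_self_add.trans hx)
        rcases eq_or_ne y 0 with rfl | h
        · exact absurd h0 hy'
        · obtain ⟨z, rfl⟩ := exists_add_of_le (Order.one_le_iff_pos.2 (pos_iff_ne_zero.2 h))
          refine ⟨z, fun _ => ?_, fun hz => hy' ?_⟩
          · rw [← e]; ring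
          · rw [add_comm]; exact h1 _ hz
      · exact ⟨y, fun h => absurd h hx, hy'⟩
  obtain ⟨y, hy, hy'⟩ := key a
  have h := hy le_rfl
  rw [add_eq_right] at h
  exact hy' (h ▸ h0)

@[elab_as_elim]
theorem pi1_strong_induction {P : 𝓜.Num → Prop}
    [hP : Pi1 (fun v : Fin 1 → 𝓜.Num => P (v 0))] (h : ∀ x, (∀ y < x, P y) → P x) (x : 𝓜.Num) :
    P x := by
  have : Pi1 (fun w : Fin 2 → 𝓜.Num => P (w 0)) := 
    ⟨Sigma1.comp (P := fun y => ¬ P y) hP.out (fun w => w 0)⟩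
  have : Pi1 (fun w : Fin 1 → 𝓜.Num => ∀ y < w 0, P y) :=
    Pi1.all _ (hP := Pi1.imp _ _ (hP := inferInstance) (hQ := this))
  refine h x (pi1_induction (P := fun x => ∀ y < x, P y) (fun y hy => absurd hy not_lt_zero) ?_ x)
  intro x ih y hy
  rcases (Order.lt_add_one_iff.1 hy).lt_or_eq with hy | rfl
  · exact ih y hy
  · exact h y ih

/-- `Δ⁰₁` comprehension. -/
theorem exists_set {P : 𝓜.Num → Prop} [h1 : Sigma1 (fun v : Fin 1 → 𝓜.Num => P (v 0))]
    [h2 : Pi1 (fun v : Fin 1 → 𝓜.Num => P (v 0))] :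
    ∃ A : 𝓜.sets, ∀ x, x ∈ (A : Set 𝓜.Num) ↔ P x := by
  obtain ⟨θ, hθ⟩ := h1.out
  obtain ⟨η, hη⟩ := h2.out.out
  have e1 : ∀ x, P x ↔ ∃ y, θ.Holds ![y, x] := fun x => hθ ![x]
  have e2 : ∀ x, ¬ P x ↔ ∃ y, η.Holds ![y, x] := fun x => hη ![x]
  obtain ⟨A, hA, h⟩ := h𝓜.out.delta01_comprehension θ (.not η) fun x => by
    rw [← e1, ← not_iff_not, e2]
    simp [BFormula.Holds]
  exact ⟨⟨A, hA⟩, fun x => by rw [h, e1]⟩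

end Closure

/-! ## Pairs and sequences -/

section Coding

variable {𝓜 : L2Structure.{u}} [h𝓜 : Fact 𝓜.IsModelRCA0]

namespace L2Structure

/-- With `sq_le_pair`, this places the code between consecutive squares. So the code determines `i +
j`, and then `i` and `j`. -/
theorem pair_lt_sq (i j : 𝓜.Num) : pair i j < (i + j + 1) * (i + j + 1) := by
  have : (i + j + 1) * (i + j + 1) = pair i j + (i + j + j + 1) := by unfold pair; ring
  rw [this]
  exact lt_add_of_pos_right _ (Order.lt_add_one_iff.2 zero_le)

theorem sq_le_pair (i j : 𝓜.Num) : (i + j) * (i + j) ≤ pair i j := le_self_add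

theorem pair_lt_of_add_lt {i j i' j' : 𝓜.Num} (h : i + j < i' + j') : pair i j < pair i' j' :=
  (pair_lt_sq i j).trans_le <| le_trans
    (mul_le_mul' (Order.add_one_le_iff.2 h) (Order.add_one_le_iff.2 h)) (sq_le_pair i' j')

theorem pair_inj {i j i' j' : 𝓜.Num} : pair i j = pair i' j' ↔ i = i' ∧ j = j' := by
  refine ⟨fun h => ?_, by rintro ⟨rfl, rfl⟩; rfl⟩
  have e : i + j = i' + j' := by
    rcases lt_trichotomy (i + j) (i' + j') with h' | h' | h'
    · exact absurd h (pair_lt_of_add_lt h').ne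
    · exact h'
    · exact absurd h (pair_lt_of_add_lt h').ne'
  have e1 : i = i' := by
    unfold pair at h
    rw [e] at h
    exact add_left_cancel h
  subst e1
  exact ⟨rfl, add_left_cancel e⟩

theorem pair_le_pair {i j i' j' : 𝓜.Num} (h1 : i ≤ i') (h2 : j ≤ j') : pair i j ≤ pair i' j' :=
  add_le_add (mul_le_mul' (add_le_add h1 h2) (add_le_add h1 h2)) h1

theorem pair_lt_pair_left {i j i' j' : 𝓜.Num} (h1 : i < i') (h2 : j ≤ j') :
    pair i j < pair i' j' := pair_lt_of_add_lt (add_lt_add_of_lt_of_le h1 h2)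

theorem pair_lt_pair_right {i j i' j' : 𝓜.Num} (h1 : i ≤ i') (h2 : j < j') :
    pair i j < pair i' j' := pair_lt_of_add_lt (add_lt_add_of_le_of_lt h1 h2)

theorem le_mul_self (a : 𝓜.Num) : a ≤ a * a := by
  rcases eq_or_ne a 0 with rfl | h
  · exact zero_le
  · exact le_mul_of_one_le_right' (Order.one_le_iff_pos.2 (pos_iff_ne_zero.2 h))

theorem left_le_pair (i j : 𝓜.Num) : i ≤ pair i j :=
  le_self_add.trans ((le_mul_self (i + j)).trans (sq_le_pair i j))

theorem right_le_pair (i j : 𝓜.Num) : j ≤ pair i j :=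
  le_add_self.trans ((le_mul_self (i + j)).trans (sq_le_pair i j))

theorem cons_inj {a l b m : 𝓜.Num} : cons a l = cons b m ↔ a = b ∧ l = m := by
  rw [← pair_inj]
  exact add_left_inj 1

theorem cons_ne_nil (a l : 𝓜.Num) : cons a l ≠ nil := h𝓜.out.add_one_ne_zero _

theorem nil_ne_cons (a l : 𝓜.Num) : nil ≠ cons a l := (cons_ne_nil a l).symm

theorem head_lt_cons (a l : 𝓜.Num) : a < cons a l := Order.lt_add_one_iff.2 (left_le_pair a l)

theorem tail_lt_cons (a l : 𝓜.Num) : l < cons a l := Order.lt_add_one_iff.2 (right_le_pair a l)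

end L2Structure

instance TermDef.nil {n : ℕ} : TermDef (fun _ : Fin n → 𝓜.Num => (nil : 𝓜.Num)) :=
  TermDef.const _

theorem Delta0.subst₂ {R : 𝓜.Num → 𝓜.Num → Prop}
    (hR : Delta0 fun v : Fin 2 → 𝓜.Num => R (v 0) (v 1))
    {k : ℕ} (s t : (Fin k → 𝓜.Num) → 𝓜.Num) [hs : TermDef s] [ht : TermDef t] :
    Delta0 fun v => R (s v) (t v) :=
  hR.subst (σ := ![s, t]) (by intro i; fin_cases i <;> assumption)

theorem Delta0.subst₃ {R : 𝓜.Num → 𝓜.Num → 𝓜.Num → Prop}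
    (hR : Delta0 fun v : Fin 3 → 𝓜.Num => R (v 0) (v 1) (v 2))
    {k : ℕ} (s t u : (Fin k → 𝓜.Num) → 𝓜.Num) [hs : TermDef s] [ht : TermDef t] [hu : TermDef u] :
    Delta0 fun v => R (s v) (t v) (u v) :=
  hR.subst (σ := ![s, t, u]) (by intro i; fin_cases i <;> assumption)

/-! ## Finite sets -/

/-- The finite set coded by the numbers `m` and `n`. -/
def codeSet (m n : 𝓜.Num) : Set 𝓜.Num := {i | ∃ q ≤ n, n = (m * (i + 1) + 1) * q}

/-- The bound `q ≤ n` in `codeSet` only serves to make membership `Δ⁰₀`. -/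
theorem mem_codeSet {m n i : 𝓜.Num} : i ∈ codeSet m n ↔ m * (i + 1) + 1 ∣ n := by
  refine ⟨fun ⟨q, _, h⟩ => ⟨q, h⟩, fun ⟨q, h⟩ => ⟨q, ?_, h⟩⟩
  rw [h]
  exact le_mul_of_one_le_left' le_add_self

instance Delta0.mem_codeSet {k : ℕ} (s t u : (Fin k → 𝓜.Num) → 𝓜.Num) [TermDef s] [TermDef t]
    [TermDef u] : Delta0 (fun v => u v ∈ codeSet (s v) (t v)) := by
  refine Delta0.subst₃ (R := fun s t u => u ∈ codeSet s t) ?_ s t u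
  unfold codeSet
  simp only [Set.mem_ofPred_eq]
  infer_instance

theorem dvd_of_dvd_add {a b c : 𝓜.Num} (h : a ∣ b + c) (hc : a ∣ c) : a ∣ b := by
  obtain ⟨x, hx⟩ := h
  obtain ⟨y, rfl⟩ := hc
  rcases le_total y x with h | h
  · obtain ⟨z, rfl⟩ := exists_add_of_le h
    refine ⟨z, ?_⟩
    rw [mul_add, add_comm] at hx
    exact add_left_cancel hx
  · obtain ⟨z, rfl⟩ := exists_add_of_le h
    rw [mul_add, add_comm, add_assoc, add_eq_left] at hx
    have : b = 0 := by
      rw [add_eq_zero] at hx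
      exact hx.2
    exact this ▸ dvd_zero a

/-- The two moduli are coprime. Write `p = m(i+1) + 1`. They differ by `m·d`, so `p` divides
`n·m·d`. As `m = d·c`, multiplying by `c(i+1)²` gives `n·(m(i+1))²`, which is congruent to `n`
because `m(i+1)` is `-1` modulo `p`. The identity `e` expresses this without subtraction. -/
theorem dvd_of_dvd_mul_coprime {m i j n d : 𝓜.Num} (hd : d ∣ m) (hij : i = j + d ∨ j = i + d)
    (h : m * (i + 1) + 1 ∣ n * (m * (j + 1) + 1)) : m * (i + 1) + 1 ∣ n := by
  obtain ⟨c, rfl⟩ := hd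
  set m := d * c with hm
  set p := m * (i + 1) + 1 with hp
  have h1 : p ∣ n * (m * d) := by
    rcases hij with rfl | rfl
    · refine dvd_of_dvd_add (c := n * (m * (j + 1) + 1)) ⟨n, ?_⟩ h
      rw [hp]; ring
    · refine dvd_of_dvd_add (c := n * p) ?_ (dvd_mul_left p n)
      refine dvd_trans h ⟨1, ?_⟩
      rw [hp]; ring
  have h2 : p ∣ n * (m * d) * (c * (i + 1) * (i + 1)) := h1.mul_right _
  refine dvd_of_dvd_add (c := p * (n * (m * (i + 1)))) ?_ (dvd_mul_right _ _)
  have e : n + p * (n * (m * (i + 1))) =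
      p * n + n * (m * d) * (c * (i + 1) * (i + 1)) := by
    have e1 : n * (m * d) * (c * (i + 1) * (i + 1)) = n * m * (d * c) * (i + 1) * (i + 1) := by ring
    rw [e1, ← hm, hp]
    ring
  rw [e]
  exact dvd_add (dvd_mul_right _ _) h2

/-- This takes the place of a factorial, whose graph has not been defined; `Σ⁰₁`-induction
multiplies by one new factor at a time. -/
theorem exists_common_multiple (k : 𝓜.Num) : ∃ m : 𝓜.Num, m ≠ 0 ∧ ∀ d < k, d ≠ 0 → d ∣ m := by
  have key : ∃ m : 𝓜.Num, m ≠ 0 ∧ ∀ d < k, d ≠ 0 → ∃ q, m = d * q := by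
    refine sigma1_induction (P := fun k : 𝓜.Num =>
      ∃ m : 𝓜.Num, m ≠ 0 ∧ ∀ d < k, d ≠ 0 → ∃ q, m = d * q) inferInstance ?_ ?_ k
    · exact ⟨1, one_ne_zero, fun d hd => absurd hd not_lt_zero⟩
    · rintro x ⟨m, hm, h⟩
      rcases eq_or_ne x 0 with rfl | hx
      · refine ⟨m, hm, fun d hd hd0 => ?_⟩
        rcases (Order.lt_add_one_iff.1 hd).lt_or_eq with hd | rfl
        · exact h d hd hd0
        · exact absurd rfl hd0
      · refine ⟨m * x, mul_ne_zero hm hx, fun d hd hd0 => ?_⟩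
        rcases (Order.lt_add_one_iff.1 hd).lt_or_eq with hd | rfl
        · obtain ⟨q, e⟩ := h d hd hd0
          exact ⟨q * x, by rw [← mul_assoc, ← e]⟩
        · exact ⟨m, mul_comm _ _⟩
  exact key

/-- Starting from `n = 1`, the modulus `m(j+1) + 1` is multiplied in for each `j ∈ A` below `k`.
Since `m` is divisible by all differences of indices below `k`, the moduli are pairwise coprime and
no other element enters. -/
theorem exists_codeSet (A : 𝓜.sets) (k : 𝓜.Num) :
    ∃ m n, ∀ i < k, i ∈ codeSet m n ↔ i ∈ (A : Set 𝓜.Num) := by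
  obtain ⟨m, hm, hdvd⟩ := exists_common_multiple k
  refine ⟨m, ?_⟩
  have key : ∀ j, ∃ n : 𝓜.Num, ∀ i < k, i ∈ codeSet m n ↔ i < j ∧ i ∈ (A : Set 𝓜.Num) := by
    refine sigma1_induction inferInstance ?_ ?_
    -- As `m ≠ 0`, every modulus exceeds `1`, so `n = 1` codes the empty set.
    · refine ⟨1, fun i _ => ?_⟩
      rw [mem_codeSet]
      refine ⟨fun h => ?_, fun h => absurd h.1 not_lt_zero⟩
      obtain ⟨q, hq⟩ := h
      have hq0 : q ≠ 0 := by
        rintro rfl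
        rw [mul_zero] at hq
        exact one_ne_zero hq
      have h1 : m * (i + 1) + 1 ≤ 1 :=
        (le_mul_of_one_le_right' (Order.one_le_iff_pos.2 (pos_iff_ne_zero.2 hq0))).trans_eq hq.symm
      rw [← Order.lt_add_one_iff, ← zero_add (1 + 1), ← add_assoc, add_lt_add_iff_right,
        zero_add, Order.lt_one_iff] at h1
      exact absurd h1 (mul_ne_zero hm (h𝓜.out.add_one_ne_zero i))
    · rintro j ⟨n, hn⟩
      by_cases hj : j < k ∧ j ∈ (A : Set 𝓜.Num)
      · refine ⟨n * (m * (j + 1) + 1), fun i hi => ?_⟩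
        rcases eq_or_ne i j with rfl | hij
        · rw [mem_codeSet]
          exact ⟨fun _ => ⟨Order.lt_add_one_iff.2 le_rfl, hj.2⟩, fun _ => dvd_mul_left _ _⟩
        · rw [Order.lt_add_one_iff, hij.le_iff_lt, ← hn i hi, mem_codeSet,
            mem_codeSet]
          refine ⟨?_, fun h => h.mul_right _⟩
          rcases hij.lt_or_gt with h | h
          · obtain ⟨d, rfl⟩ := exists_add_of_le h.le
            refine dvd_of_dvd_mul_coprime (d := d) (hdvd d ?_ ?_) (Or.inr rfl)
            · exact le_add_self.trans_lt hj.1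
            · rintro rfl
              simp at hij
          · obtain ⟨d, rfl⟩ := exists_add_of_le h.le
            refine dvd_of_dvd_mul_coprime (d := d) (hdvd d ?_ ?_) (Or.inl rfl)
            · exact le_add_self.trans_lt hi
            · rintro rfl
              simp at hij
      · refine ⟨n, fun i hi => ?_⟩
        rw [hn i hi]
        refine ⟨fun h => ⟨h.1.trans (Order.lt_add_one_iff.2 le_rfl), h.2⟩, fun h => ⟨?_, h.2⟩⟩
        rcases (Order.lt_add_one_iff.1 h.1).lt_or_eq with h' | rfl
        · exact h'
        · exact absurd ⟨hi, h.2⟩ hj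
  obtain ⟨n, hn⟩ := key k
  exact ⟨n, fun i hi => by rw [hn i hi]; exact and_iff_right hi⟩

/-! ## Course of values recursion -/

/-- The set is glued from finite approximations given by codes. Approximations agree where both are
defined, by locality, and exist for every length, by `Σ⁰₁`-induction. Membership can thus be
expressed with some or with every approximation, hence is `Δ⁰₁`. -/
theorem exists_set_recursion {Φ : Set 𝓜.Num → 𝓜.Num → Prop}
    (hloc : ∀ S S' x, (∀ z < x, z ∈ S ↔ z ∈ S') → (Φ S x ↔ Φ S' x))
    (hdef : Delta0 fun v : Fin 3 → 𝓜.Num => Φ (codeSet (v 0) (v 1)) (v 2)) :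
    ∃ Y : 𝓜.sets, ∀ x, x ∈ (Y : Set 𝓜.Num) ↔ Φ Y x := by
  have inst : ∀ {k : ℕ} (s t u : (Fin k → 𝓜.Num) → 𝓜.Num) [TermDef s] [TermDef t] [TermDef u],
      Delta0 fun v => Φ (codeSet (s v) (t v)) (u v) :=
    fun s t u => Delta0.subst₃ (R := fun s t u => Φ (codeSet s t) u) hdef s t u
  let Good : 𝓜.Num → 𝓜.Num → 𝓜.Num → Prop := fun x m n =>
    ∀ z < x, z ∈ codeSet m n ↔ Φ (codeSet m n) z
  have uniq : ∀ x m n m' n', Good x m n → Good x m' n' →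
      ∀ z < x, z ∈ codeSet m n ↔ z ∈ codeSet m' n' := by
    intro x m n m' n' h h' z
    refine sigma1_strong_induction (P := fun z => z < x → (z ∈ codeSet m n ↔ z ∈ codeSet m' n'))
      ?_ z
    intro z ih hz
    rw [h z hz, h' z hz]
    exact hloc _ _ _ fun y hy => ih y hy (hy.trans hz)
  have ex : ∀ x, ∃ m n, Good x m n := by
    refine sigma1_induction inferInstance ?_ ?_
    · exact ⟨0, 0, fun z hz => absurd hz not_lt_zero⟩
    · rintro x ⟨m, n, h⟩
      -- The approximation is extended by a decision at `x`: first as a set of the model, which is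
      -- then coded again by numbers.
      obtain ⟨A, hA⟩ := exists_set (P := fun z =>
        (z < x ∧ z ∈ codeSet m n) ∨ (z = x ∧ Φ (codeSet m n) z))
      obtain ⟨m', n', h'⟩ := exists_codeSet A (x + 1)
      have agree : ∀ z < x, z ∈ codeSet m n ↔ z ∈ codeSet m' n' := by
        intro z hz
        rw [h' z (hz.trans (Order.lt_add_one_iff.2 le_rfl)), hA]
        simp [hz, hz.ne]
      refine ⟨m', n', fun z hz => ?_⟩
      rcases (Order.lt_add_one_iff.1 hz).lt_or_eq with hz' | rfl
      · rw [← agree z hz', h z hz']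
        exact hloc _ _ _ fun y hy => agree y (hy.trans hz')
      · rw [h' z hz, hA, ← hloc _ _ _ agree]
        simp
  obtain ⟨Y, hY⟩ : ∃ Y : 𝓜.sets, ∀ x, x ∈ (Y : Set 𝓜.Num) ↔
      ∃ m n, Good (x + 1) m n ∧ x ∈ codeSet m n := by
    have e : ∀ x, (∃ m n, Good (x + 1) m n ∧ x ∈ codeSet m n) ↔
        ∀ m n, Good (x + 1) m n → x ∈ codeSet m n := by
      intro x
      constructor
      · rintro ⟨m, n, h, hx⟩ m' n' h'
        exact (uniq _ _ _ _ _ h h' x (Order.lt_add_one_iff.2 le_rfl)).1 hx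
      · intro h
        obtain ⟨m, n, h'⟩ := ex (x + 1)
        exact ⟨m, n, h', h m n h'⟩
    have h2 : Pi1 fun v : Fin 1 → 𝓜.Num =>
        ∃ m n, Good (v 0 + 1) m n ∧ v 0 ∈ codeSet m n := by
      simp only [e]
      infer_instance
    exact exists_set (h2 := h2)
  have hYc : ∀ x m n, Good x m n → ∀ z < x, z ∈ codeSet m n ↔ z ∈ (Y : Set 𝓜.Num) := by
    intro x m n h z hz
    have h1 : Good (z + 1) m n := fun y hy => h y (hy.trans_le (Order.add_one_le_iff.2 hz))
    rw [hY]
    constructor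
    · exact fun h' => ⟨m, n, h1, h'⟩
    · rintro ⟨m', n', h', hz'⟩
      exact (uniq _ _ _ _ _ h' h1 z (Order.lt_add_one_iff.2 le_rfl)).1 hz'
  refine ⟨Y, fun x => ?_⟩
  obtain ⟨m, n, h⟩ := ex (x + 1)
  have hx : x < x + 1 := Order.lt_add_one_iff.2 le_rfl
  rw [← hYc _ _ _ h x hx, h x hx]
  exact hloc _ _ _ fun z hz => hYc _ _ _ h z (hz.trans hx)

/-- Recursion for ternary relations: the value at `(n, a, b)` may depend on the values at
`(n', a', b')` with `n' ≤ n`, `a' < a` and `b' ≤ b`. -/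
theorem exists_rel_recursion (Φ : (𝓜.Num → 𝓜.Num → 𝓜.Num → Prop) →
      𝓜.Num → 𝓜.Num → 𝓜.Num → Prop)
    (hdef : Delta0 fun v : Fin 5 → 𝓜.Num => Φ (fun n a b => n ≤ v 2 ∧ a < v 3 ∧ b ≤ v 4 ∧
      pair n (pair a b) ∈ codeSet (v 0) (v 1)) (v 2) (v 3) (v 4)) :
    ∃ Y : 𝓜.sets, ∀ n a b, pair n (pair a b) ∈ (Y : Set 𝓜.Num) ↔
      Φ (fun n' a' b' => n' ≤ n ∧ a' < a ∧ b' ≤ b ∧ pair n' (pair a' b') ∈ (Y : Set 𝓜.Num))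
        n a b := by
  have inst : ∀ {k : ℕ} (t₀ t₁ t₂ t₃ t₄ : (Fin k → 𝓜.Num) → 𝓜.Num) [TermDef t₀] [TermDef t₁]
      [TermDef t₂] [TermDef t₃] [TermDef t₄], Delta0 fun v =>
      Φ (fun n a b => n ≤ t₂ v ∧ a < t₃ v ∧ b ≤ t₄ v ∧
        pair n (pair a b) ∈ codeSet (t₀ v) (t₁ v)) (t₂ v) (t₃ v) (t₄ v) :=
    fun t₀ t₁ t₂ t₃ t₄ => hdef.subst (σ := ![t₀, t₁, t₂, t₃, t₄])
      (by intro i; fin_cases i <;> assumption)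
  let Ψ : Set 𝓜.Num → 𝓜.Num → Prop := fun S x =>
    ∃ n ≤ x, ∃ a ≤ x, ∃ b ≤ x, x = pair n (pair a b) ∧
      Φ (fun n' a' b' => n' ≤ n ∧ a' < a ∧ b' ≤ b ∧ pair n' (pair a' b') ∈ S) n a b
  have hloc : ∀ S S' x, (∀ z < x, z ∈ S ↔ z ∈ S') → (Ψ S x ↔ Ψ S' x) := by
    intro S S' x h
    refine exists_congr fun n => and_congr_right fun _ => exists_congr fun a =>
      and_congr_right fun _ => exists_congr fun b => and_congr_right fun _ =>
      and_congr_right fun e => ?_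
    refine iff_of_eq (congrArg (fun R => Φ R n a b) ?_)
    funext n' a' b'
    refine propext (and_congr_right fun hn => and_congr_right fun ha => and_congr_right fun hb => ?_)
    -- The code of the triple decreases, because pairing is strictly monotone and the middle
    -- component drops.
    exact h _ (e ▸ pair_lt_pair_right hn (pair_lt_pair_left ha hb))
  obtain ⟨Y, hY⟩ := exists_set_recursion hloc inferInstance
  refine ⟨Y, fun n a b => ?_⟩
  rw [hY]
  constructor
  · rintro ⟨n', -, a', -, b', -, e, h⟩
    rw [pair_inj, pair_inj] at e
    obtain ⟨rfl, rfl, rfl⟩ := e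
    exact h
  · intro h
    exact ⟨n, left_le_pair _ _, a, (left_le_pair _ _).trans (right_le_pair _ _), b,
      (right_le_pair _ _).trans (right_le_pair _ _), rfl, h⟩

end Coding

/-! ## Orders -/

section Orders

variable {𝓜 : L2Structure.{u}} [h𝓜 : Fact 𝓜.IsModelRCA0]

attribute [simp] L2Structure.pair_inj L2Structure.cons_inj L2Structure.cons_ne_nil
  L2Structure.nil_ne_cons L2Structure.head_lt_cons L2Structure.tail_lt_cons

namespace L2Structure

@[simp]
theorem exp_lt_cons (γ δ ρ : 𝓜.Num) : γ < cons (pair γ δ) ρ :=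
  (left_le_pair γ δ).trans_lt (head_lt_cons _ _)

@[simp]
theorem coeff_lt_cons (γ δ ρ : 𝓜.Num) : δ < cons (pair γ δ) ρ :=
  (right_le_pair γ δ).trans_lt (head_lt_cons _ _)

@[simp]
theorem exp_le_cons (γ δ ρ : 𝓜.Num) : γ ≤ cons (pair γ δ) ρ := (exp_lt_cons γ δ ρ).le

@[simp]
theorem head_le_cons (a l : 𝓜.Num) : a ≤ cons a l := (head_lt_cons a l).le

@[simp]
theorem tail_le_cons (a l : 𝓜.Num) : l ≤ cons a l := (tail_lt_cons a l).le

end L2Structure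

instance Delta0.coded_dom {n : ℕ} (D : 𝓜.sets) (L : Set 𝓜.Num) (t : (Fin n → 𝓜.Num) → 𝓜.Num)
    [TermDef t] : Delta0 fun v => (codedOrder (D : Set 𝓜.Num) L).dom (t v) :=
  inferInstanceAs (Delta0 fun v => t v ∈ (D : Set 𝓜.Num))

instance Delta0.coded_lt {n : ℕ} (D : Set 𝓜.Num) (L : 𝓜.sets) (s t : (Fin n → 𝓜.Num) → 𝓜.Num)
    [TermDef s] [TermDef t] : Delta0 fun v => (codedOrder D (L : Set 𝓜.Num)).lt (s v) (t v) :=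
  inferInstanceAs (Delta0 fun v => pair (s v) (t v) ∈ (L : Set 𝓜.Num))

instance Delta0.tower_dom {n : ℕ} (T : 𝓜.sets) (R : Set 𝓜.Num) (k t : (Fin n → 𝓜.Num) → 𝓜.Num)
    [TermDef k] [TermDef t] : Delta0 fun v => (towerLevel (T : Set 𝓜.Num) R (k v)).dom (t v) :=
  inferInstanceAs (Delta0 fun v => pair (k v) (t v) ∈ (T : Set 𝓜.Num))

instance Delta0.tower_lt {n : ℕ} (T : Set 𝓜.Num) (R : 𝓜.sets)
    (k s t : (Fin n → 𝓜.Num) → 𝓜.Num) [TermDef k] [TermDef s] [TermDef t] :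
    Delta0 fun v => (towerLevel T (R : Set 𝓜.Num) (k v)).lt (s v) (t v) :=
  inferInstanceAs (Delta0 fun v => pair (k v) (pair (s v) (t v)) ∈ (R : Set 𝓜.Num))

/-! ### Comprehension for relations, and existence of Goodstein values and towers -/

theorem exists_set₂ (P : 𝓜.Num → 𝓜.Num → Prop) [h : Delta0 fun v : Fin 2 → 𝓜.Num => P (v 0) (v 1)] :
    ∃ A : 𝓜.sets, ∀ x y, pair x y ∈ (A : Set 𝓜.Num) ↔ P x y := by
  have inst : ∀ {k : ℕ} (s t : (Fin k → 𝓜.Num) → 𝓜.Num) [TermDef s] [TermDef t],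
      Delta0 fun v => P (s v) (t v) := fun s t => h.subst₂ s t
  obtain ⟨A, hA⟩ := exists_set (P := fun p : 𝓜.Num => ∃ x ≤ p, ∃ y ≤ p, p = pair x y ∧ P x y)
  refine ⟨A, fun x y => ?_⟩
  rw [hA]
  constructor
  · rintro ⟨x', -, y', -, e, h⟩
    rw [pair_inj] at e
    obtain ⟨rfl, rfl⟩ := e
    exact h
  · exact fun h => ⟨x, left_le_pair _ _, y, right_le_pair _ _, rfl, h⟩

theorem exists_set₃ (P : 𝓜.Num → 𝓜.Num → 𝓜.Num → Prop)
    [h : Delta0 fun v : Fin 3 → 𝓜.Num => P (v 0) (v 1) (v 2)] :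
    ∃ A : 𝓜.sets, ∀ x y z, pair x (pair y z) ∈ (A : Set 𝓜.Num) ↔ P x y z := by
  have inst : ∀ {k : ℕ} (s t u : (Fin k → 𝓜.Num) → 𝓜.Num) [TermDef s] [TermDef t] [TermDef u],
      Delta0 fun v => P (s v) (t v) (u v) := fun s t u => h.subst₃ s t u
  obtain ⟨A, hA⟩ := exists_set₂ (fun x q : 𝓜.Num => ∃ y ≤ q, ∃ z ≤ q, q = pair y z ∧ P x y z)
  refine ⟨A, fun x y z => ?_⟩
  rw [hA]
  constructor
  · rintro ⟨x', -, y', -, e, h⟩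
    rw [pair_inj] at e
    obtain ⟨rfl, rfl⟩ := e
    exact h
  · exact fun h => ⟨y, left_le_pair _ _, z, right_le_pair _ _, rfl, h⟩

/-- The simultaneous recursion is disentangled. The comparison `C` is defined on all numbers,
whether or not they are terms; the domain `B` then uses `C` as a parameter; finally `C` is
restricted to the domain. Unused components of the recursion scheme are set to `0`. -/
theorem exists_isGoodstein (D L : 𝓜.sets) : ∃ E K : 𝓜.sets,
    (codedOrder (D : Set 𝓜.Num) L).IsGoodstein (codedOrder (E : Set 𝓜.Num) K) := by
  obtain ⟨C, hC⟩ := exists_rel_recursion (𝓜 := 𝓜) (fun S n σ τ => (σ = nil ∧ τ ≠ nil) ∨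
    ∃ γ < σ, ∃ δ < σ, ∃ ρ < σ, ∃ γ' < τ, ∃ δ' < τ, ∃ ρ' < τ,
      σ = cons (pair γ δ) ρ ∧ τ = cons (pair γ' δ') ρ' ∧
      (S n γ γ' ∨ (γ = γ' ∧ (pair δ δ' ∈ (L : Set 𝓜.Num) ∨ (δ = δ' ∧ S n ρ ρ'))))) inferInstance
  replace hC : ∀ σ τ, pair 0 (pair σ τ) ∈ (C : Set 𝓜.Num) ↔ (σ = nil ∧ τ ≠ nil) ∨
      ∃ γ δ ρ γ' δ' ρ', σ = cons (pair γ δ) ρ ∧ τ = cons (pair γ' δ') ρ' ∧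
      (pair 0 (pair γ γ') ∈ (C : Set 𝓜.Num) ∨ (γ = γ' ∧ (pair δ δ' ∈ (L : Set 𝓜.Num) ∨
        (δ = δ' ∧ pair 0 (pair ρ ρ') ∈ (C : Set 𝓜.Num))))) := by
    intro σ τ
    rw [hC]
    refine or_congr_right ⟨?_, ?_⟩
    · rintro ⟨γ, -, δ, -, ρ, -, γ', -, δ', -, ρ', -, e, e', h⟩
      refine ⟨γ, δ, ρ, γ', δ', ρ', e, e', ?_⟩
      tauto
    · rintro ⟨γ, δ, ρ, γ', δ', ρ', rfl, rfl, h⟩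
      refine ⟨γ, ?_, δ, ?_, ρ, ?_, γ', ?_, δ', ?_, ρ', ?_, rfl, rfl, ?_⟩
      on_goal 7 => simpa using h
      all_goals simp
  obtain ⟨B, hB⟩ := exists_rel_recursion (𝓜 := 𝓜) (fun S n σ b => σ = nil ∨
    ∃ γ < σ, ∃ δ < σ, ∃ ρ < σ, σ = cons (pair γ δ) ρ ∧ S n γ b ∧ δ ∈ (D : Set 𝓜.Num) ∧ S n ρ b ∧
      ∀ γ' < ρ, ∀ δ' < ρ, ∀ ρ' < ρ, ρ = cons (pair γ' δ') ρ' →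
        pair 0 (pair γ' γ) ∈ (C : Set 𝓜.Num)) inferInstance
  replace hB : ∀ σ, pair 0 (pair σ 0) ∈ (B : Set 𝓜.Num) ↔ σ = nil ∨
      ∃ γ δ ρ, σ = cons (pair γ δ) ρ ∧ pair 0 (pair γ 0) ∈ (B : Set 𝓜.Num) ∧
      δ ∈ (D : Set 𝓜.Num) ∧ pair 0 (pair ρ 0) ∈ (B : Set 𝓜.Num) ∧
      ∀ γ' δ' ρ', ρ = cons (pair γ' δ') ρ' → pair 0 (pair γ' γ) ∈ (C : Set 𝓜.Num) := by
    intro σ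
    rw [hB]
    refine or_congr_right ⟨?_, ?_⟩
    · rintro ⟨γ, -, δ, -, ρ, -, e, h1, h2, h3, h⟩
      refine ⟨γ, δ, ρ, e, h1.2.2.2, h2, h3.2.2.2, ?_⟩
      rintro γ' δ' ρ' rfl
      exact h γ' (by simp) δ' (by simp) ρ' (by simp) rfl
    · rintro ⟨γ, δ, ρ, rfl, h1, h2, h3, h⟩
      refine ⟨γ, by simp, δ, by simp, ρ, by simp, rfl, ⟨le_rfl, by simp, le_rfl, h1⟩, h2,
        ⟨le_rfl, by simp, le_rfl, h3⟩, ?_⟩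
      intro γ' _ δ' _ ρ' _
      exact h γ' δ' ρ'
  obtain ⟨E, hE⟩ := exists_set (P := fun σ : 𝓜.Num => pair 0 (pair σ 0) ∈ (B : Set 𝓜.Num))
  obtain ⟨K, hK⟩ := exists_set₂ (fun σ τ : 𝓜.Num => σ ∈ (E : Set 𝓜.Num) ∧ τ ∈ (E : Set 𝓜.Num) ∧
    pair 0 (pair σ τ) ∈ (C : Set 𝓜.Num))
  simp only [← hE] at hB
  have dom : ∀ γ δ ρ, cons (pair γ δ) ρ ∈ (E : Set 𝓜.Num) →
      γ ∈ (E : Set 𝓜.Num) ∧ ρ ∈ (E : Set 𝓜.Num) := by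
    intro γ δ ρ h
    rw [hB] at h
    simp only [cons_ne_nil, cons_inj, pair_inj, false_or] at h
    obtain ⟨γ', δ', ρ', ⟨⟨rfl, rfl⟩, rfl⟩, h1, -, h2, -⟩ := h
    exact ⟨h1, h2⟩
  refine ⟨E, K, ?_, ?_⟩
  · intro σ
    refine (hB σ).trans (or_congr_right ?_)
    refine exists_congr fun γ => exists_congr fun δ => exists_congr fun ρ =>
      and_congr_right fun _ => and_congr_right fun h1 => and_congr_right fun _ =>
      and_congr_right fun h2 => forall_congr' fun γ' => forall_congr' fun δ' =>
      forall_congr' fun ρ' => forall_congr' fun e => ?_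
    have h3 : γ' ∈ (E : Set 𝓜.Num) := by
      rw [e] at h2
      exact (dom _ _ _ h2).1
    exact (((hK γ' γ).trans (and_iff_right h3)).trans (and_iff_right h1)).symm
  · intro σ τ
    refine (hK σ τ).trans (and_congr_right fun hσ => and_congr_right fun hτ => ?_)
    rw [hC]
    refine or_congr_right ?_
    refine exists_congr fun γ => exists_congr fun δ => exists_congr fun ρ => exists_congr fun γ' =>
      exists_congr fun δ' => exists_congr fun ρ' => and_congr_right fun e =>
      and_congr_right fun e' => ?_
    rw [e] at hσ
    rw [e'] at hτ
    have h1 : (codedOrder (E : Set 𝓜.Num) K).lt γ γ' ↔ pair 0 (pair γ γ') ∈ (C : Set 𝓜.Num) :=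
      ((hK _ _).trans (and_iff_right (dom _ _ _ hσ).1)).trans (and_iff_right (dom _ _ _ hτ).1)
    have h2 : (codedOrder (E : Set 𝓜.Num) K).lt ρ ρ' ↔ pair 0 (pair ρ ρ') ∈ (C : Set 𝓜.Num) :=
      ((hK _ _).trans (and_iff_right (dom _ _ _ hσ).2)).trans (and_iff_right (dom _ _ _ hτ).2)
    rw [h1, h2]
    rfl

/-- The construction is that of `exists_isGoodstein`, with the level `n` as a recursion argument.
Linearity ensures that restricting `L` to `D` changes nothing at level `0`. -/
theorem exists_isTower (D L : 𝓜.sets) (hX : (codedOrder (D : Set 𝓜.Num) L).IsLinear) :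
    ∃ T R : 𝓜.sets, IsTower (codedOrder (D : Set 𝓜.Num) L) T R := by
  obtain ⟨C, hC⟩ := exists_rel_recursion (𝓜 := 𝓜) (fun S n s t =>
    (n = 0 ∧ pair s t ∈ (L : Set 𝓜.Num)) ∨ ∃ k < n, n = k + 1 ∧ ((s = nil ∧ t ≠ nil) ∨
    ∃ a < s, ∃ l < s, ∃ b < t, ∃ m < t, s = cons a l ∧ t = cons b m ∧
      (S k a b ∨ (a = b ∧ S n l m)))) inferInstance
  obtain ⟨B, hB⟩ := exists_rel_recursion (𝓜 := 𝓜) (fun S n s z =>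
    (n = 0 ∧ s ∈ (D : Set 𝓜.Num)) ∨ ∃ k < n, n = k + 1 ∧ (s = nil ∨
    ∃ a < s, ∃ l < s, s = cons a l ∧ S k a z ∧ S n l z ∧
      ∀ b < l, ∀ m < l, l = cons b m → (pair k (pair b a) ∈ (C : Set 𝓜.Num) ∨ b = a)))
    inferInstance
  obtain ⟨T, hT⟩ := exists_set₂ (fun n s : 𝓜.Num => pair n (pair s 0) ∈ (B : Set 𝓜.Num))
  obtain ⟨R, hR⟩ := exists_set₃ (fun n s t : 𝓜.Num => pair n s ∈ (T : Set 𝓜.Num) ∧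
    pair n t ∈ (T : Set 𝓜.Num) ∧ pair n (pair s t) ∈ (C : Set 𝓜.Num))
  have add_one_ne : ∀ n : 𝓜.Num, n + 1 ≠ 0 := h𝓜.out.add_one_ne_zero
  have C0 : ∀ s t, pair 0 (pair s t) ∈ (C : Set 𝓜.Num) ↔ pair s t ∈ (L : Set 𝓜.Num) := by
    intro s t
    rw [hC]
    simp [(add_one_ne _).symm]
  have C1 : ∀ n s t, pair (n + 1) (pair s t) ∈ (C : Set 𝓜.Num) ↔ (s = nil ∧ t ≠ nil) ∨
      ∃ a l b m, s = cons a l ∧ t = cons b m ∧ (pair n (pair a b) ∈ (C : Set 𝓜.Num) ∨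
        (a = b ∧ pair (n + 1) (pair l m) ∈ (C : Set 𝓜.Num))) := by
    intro n s t
    rw [hC]
    constructor
    · rintro (⟨h, -⟩ | ⟨k, -, e, h⟩)
      · exact absurd h (add_one_ne n)
      · obtain rfl := add_right_cancel e
        refine h.imp_right ?_
        rintro ⟨a, -, l, -, b, -, m, -, e, e', h⟩
        exact ⟨a, l, b, m, e, e', by tauto⟩
    · intro h
      refine Or.inr ⟨n, Order.lt_add_one_iff.2 le_rfl, rfl, h.imp_right ?_⟩
      rintro ⟨a, l, b, m, rfl, rfl, h⟩
      refine ⟨a, by simp, l, by simp, b, by simp, m, by simp, rfl, rfl, ?_⟩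
      simpa using h
  have T0 : ∀ s, pair 0 s ∈ (T : Set 𝓜.Num) ↔ s ∈ (D : Set 𝓜.Num) := by
    intro s
    rw [hT, hB]
    simp [(add_one_ne _).symm]
  have T1 : ∀ n s, pair (n + 1) s ∈ (T : Set 𝓜.Num) ↔ s = nil ∨
      ∃ a l, s = cons a l ∧ pair n a ∈ (T : Set 𝓜.Num) ∧ pair (n + 1) l ∈ (T : Set 𝓜.Num) ∧
        ∀ b m, l = cons b m → (pair n (pair b a) ∈ (C : Set 𝓜.Num) ∨ b = a) := by
    intro n s
    rw [hT, hB]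
    simp only [hT]
    constructor
    · rintro (⟨h, -⟩ | ⟨k, -, e, h⟩)
      · exact absurd h (add_one_ne n)
      · obtain rfl := add_right_cancel e
        refine h.imp_right ?_
        rintro ⟨a, -, l, -, e, h1, h2, h⟩
        refine ⟨a, l, e, h1.2.2.2, h2.2.2.2, ?_⟩
        rintro b m rfl
        exact h b (by simp) m (by simp) rfl
    · intro h
      refine Or.inr ⟨n, Order.lt_add_one_iff.2 le_rfl, rfl, h.imp_right ?_⟩
      rintro ⟨a, l, rfl, h1, h2, h⟩
      refine ⟨a, by simp, l, by simp, rfl, ⟨?_, by simp, le_rfl, h1⟩, ⟨le_rfl, by simp, le_rfl, h2⟩,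
        fun b _ m _ => h b m⟩
      exact le_self_add
  have dom : ∀ n a l, pair (n + 1) (cons a l) ∈ (T : Set 𝓜.Num) →
      pair n a ∈ (T : Set 𝓜.Num) ∧ pair (n + 1) l ∈ (T : Set 𝓜.Num) := by
    intro n a l h
    rw [T1] at h
    simp only [cons_ne_nil, cons_inj, false_or] at h
    obtain ⟨a', l', ⟨rfl, rfl⟩, h1, h2, -⟩ := h
    exact ⟨h1, h2⟩
  refine ⟨T, R, T0, ?_, fun n => ⟨?_, ?_⟩⟩
  · intro x y
    refine (hR 0 x y).trans ?_
    rw [T0, T0, C0]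
    exact ⟨fun h => h.2.2, fun h => ⟨(hX.dom_of_lt x y h).1, (hX.dom_of_lt x y h).2, h⟩⟩
  · intro s
    refine (T1 n s).trans (or_congr_right ?_)
    refine exists_congr fun a => exists_congr fun l => and_congr_right fun _ =>
      and_congr_right fun h1 => and_congr_right fun h2 => forall_congr' fun b =>
      forall_congr' fun m => forall_congr' fun e => or_congr_left ?_
    rw [e] at h2
    exact (((hR n b a).trans (and_iff_right (dom _ _ _ h2).1)).trans (and_iff_right h1)).symm
  · intro s t
    refine (hR (n + 1) s t).trans (and_congr_right fun hs => and_congr_right fun ht => ?_)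
    rw [C1]
    refine or_congr_right ?_
    refine exists_congr fun a => exists_congr fun l => exists_congr fun b => exists_congr fun m =>
      and_congr_right fun e => and_congr_right fun e' => ?_
    rw [e] at hs
    rw [e'] at ht
    have h1 : (towerLevel (T : Set 𝓜.Num) R n).lt a b ↔ pair n (pair a b) ∈ (C : Set 𝓜.Num) :=
      ((hR _ _ _).trans (and_iff_right (dom _ _ _ hs).1)).trans (and_iff_right (dom _ _ _ ht).1)
    have h2 : (towerLevel (T : Set 𝓜.Num) R (n + 1)).lt l m ↔
        pair (n + 1) (pair l m) ∈ (C : Set 𝓜.Num) :=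
      ((hR _ _ _).trans (and_iff_right (dom _ _ _ hs).2)).trans (and_iff_right (dom _ _ _ ht).2)
    rw [h1, h2]

end Orders

/-! ## Well founded orders -/

section WellFounded

variable {𝓜 : L2Structure.{u}} [h𝓜 : Fact 𝓜.IsModelRCA0]

namespace L2Structure.OrderData

/-- There is no infinite descending sequence with a `Σ⁰₁` graph. -/
theorem IsWellFounded.false_of_descending {X : OrderData 𝓜} (hX : X.IsWellFounded)
    (P : 𝓜.Num → 𝓜.Num → Prop) [hP : Sigma1 fun v : Fin 2 → 𝓜.Num => P (v 0) (v 1)]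
    (ex : ∀ i, ∃ x, P i x) (uniq : ∀ i x y, P i x → P i y → x = y) (dom : ∀ i x, P i x → X.dom x)
    (desc : ∀ i x y, P i x → P (i + 1) y → X.lt y x) : False := by
  have inst : ∀ {k : ℕ} (s t : (Fin k → 𝓜.Num) → 𝓜.Num) [TermDef s] [TermDef t],
      Sigma1 fun v => P (s v) (t v) := fun s t =>
    hP.subst (σ := ![s, t]) (by intro i; fin_cases i <;> assumption)
  -- A total single-valued `Σ⁰₁` graph is also `Π⁰₁`, so it is a set of the model.
  have e : ∀ i x, P i x ↔ ∀ y, P i y → y = x := by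
    intro i x
    refine ⟨fun h y hy => uniq i y x hy h, fun h => ?_⟩
    obtain ⟨y, hy⟩ := ex i
    rwa [← h y hy]
  have h1 : Sigma1 fun v : Fin 1 → 𝓜.Num => ∃ i x, v 0 = pair i x ∧ P i x := inferInstance
  have h2 : Pi1 fun v : Fin 1 → 𝓜.Num => ∃ i x, v 0 = pair i x ∧ P i x := by
    have : ∀ p, (∃ i x, p = pair i x ∧ P i x) ↔
        ∃ i ≤ p, ∃ x ≤ p, p = pair i x ∧ ∀ y, P i y → y = x := by
      intro p
      constructor
      · rintro ⟨i, x, rfl, h⟩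
        exact ⟨i, left_le_pair _ _, x, right_le_pair _ _, rfl, (e i x).1 h⟩
      · rintro ⟨i, -, x, -, rfl, h⟩
        exact ⟨i, x, rfl, (e i x).2 h⟩
    simp only [this]
    infer_instance
  obtain ⟨F, hF⟩ := exists_set (P := fun p => ∃ i x, p = pair i x ∧ P i x)
  have hF' : ∀ i x, pair i x ∈ (F : Set 𝓜.Num) ↔ P i x := by
    intro i x
    rw [hF]
    simp
  refine hX ⟨F, F.2, ?_, ?_, ?_⟩
  · intro i
    obtain ⟨x, hx⟩ := ex i
    exact ⟨x, (hF' i x).2 hx, fun y hy => uniq i y x ((hF' i y).1 hy) hx⟩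
  · intro i x h
    exact dom i x ((hF' i x).1 h)
  · intro i x y h h'
    exact desc i x y ((hF' i x).1 h) ((hF' _ y).1 h')

end L2Structure.OrderData

/-! ### The orders `ω` and `1`, and sums of well orders -/

theorem exists_omega : ∃ D L : 𝓜.sets, (codedOrder (D : Set 𝓜.Num) L).IsWellOrder ∧
    (∀ x, (codedOrder (D : Set 𝓜.Num) L).dom x) ∧
    ∀ x y, (codedOrder (D : Set 𝓜.Num) L).lt x y ↔ x < y := by
  obtain ⟨D, hD⟩ := exists_set (P := fun _ : 𝓜.Num => True)
  obtain ⟨L, hL⟩ := exists_set₂ (fun x y : 𝓜.Num => x < y)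
  have hlt : ∀ x y, (codedOrder (D : Set 𝓜.Num) L).lt x y ↔ x < y := hL
  have hdom : ∀ x, (codedOrder (D : Set 𝓜.Num) L).dom x := fun x => (hD x).2 trivial
  refine ⟨D, L, ⟨⟨fun x y _ => ⟨hdom x, hdom y⟩, ?_, ?_, ?_⟩, ?_⟩, hdom, hlt⟩
  · intro x
    rw [hlt]
    exact lt_irrefl x
  · intro x y z
    simp only [hlt]
    exact lt_trans
  · intro x y _ _
    simp only [hlt]
    exact lt_trichotomy x y
  · rintro ⟨F, hF, tot, -, desc⟩
    lift F to 𝓜.sets using hF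
    -- By `Π⁰₁`-induction no `x` is a value of the sequence, since the next value would be a smaller
    -- one.
    have key : ∀ x i, pair i x ∉ (F : Set 𝓜.Num) := by
      intro x
      refine pi1_strong_induction (P := fun x => ∀ i, pair i x ∉ (F : Set 𝓜.Num)) ?_ x
      intro x ih i hi
      obtain ⟨y, hy, -⟩ := tot (i + 1)
      exact ih y ((hlt y x).1 (desc i x y hi hy)) _ hy
    obtain ⟨x, hx, -⟩ := tot 0
    exact key x 0 hx

theorem exists_one : ∃ D L : 𝓜.sets, (codedOrder (D : Set 𝓜.Num) L).IsWellOrder ∧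
    ∀ x, (codedOrder (D : Set 𝓜.Num) L).dom x ↔ x = 0 := by
  obtain ⟨D, hD⟩ := exists_set (P := fun x : 𝓜.Num => x = 0)
  obtain ⟨L, hL⟩ := exists_set₂ (fun _ _ : 𝓜.Num => False)
  have hlt : ∀ x y, ¬ (codedOrder (D : Set 𝓜.Num) L).lt x y := fun x y => (hL x y).1
  have hdom : ∀ x, (codedOrder (D : Set 𝓜.Num) L).dom x ↔ x = 0 := hD
  refine ⟨D, L, ⟨⟨fun x y h => (hlt x y h).elim, fun x => hlt x x,
    fun x y z h => (hlt x y h).elim, ?_⟩, ?_⟩, hdom⟩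
  · intro x y hx hy
    rw [hdom] at hx hy
    exact Or.inr (Or.inl (hx.trans hy.symm))
  · rintro ⟨F, -, tot, -, desc⟩
    obtain ⟨x, hx, -⟩ := tot 0
    obtain ⟨y, hy, -⟩ := tot (0 + 1)
    exact hlt y x (desc 0 x y hx hy)

/-- `X` is the sum of the orders `X₁` and `X₂`, with elements `pair 0 x` and `pair 1 y`. -/
structure IsSum (X₁ X₂ X : OrderData 𝓜) : Prop where
  dom_iff : ∀ z, X.dom z ↔ (∃ x, z = pair 0 x ∧ X₁.dom x) ∨ ∃ x, z = pair 1 x ∧ X₂.dom x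
  lt_iff : ∀ z w, X.lt z w ↔ (∃ x y, z = pair 0 x ∧ w = pair 0 y ∧ X₁.lt x y) ∨
    (∃ x y, z = pair 0 x ∧ w = pair 1 y ∧ X₁.dom x ∧ X₂.dom y) ∨
    ∃ x y, z = pair 1 x ∧ w = pair 1 y ∧ X₂.lt x y

theorem exists_isSum (D₁ L₁ D₂ L₂ : 𝓜.sets) : ∃ D L : 𝓜.sets,
    IsSum (codedOrder (D₁ : Set 𝓜.Num) L₁) (codedOrder (D₂ : Set 𝓜.Num) L₂)
      (codedOrder (D : Set 𝓜.Num) L) := by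
  obtain ⟨D, hD⟩ := exists_set (P := fun z : 𝓜.Num =>
    (∃ x ≤ z, z = pair 0 x ∧ x ∈ (D₁ : Set 𝓜.Num)) ∨ ∃ x ≤ z, z = pair 1 x ∧ x ∈ (D₂ : Set 𝓜.Num))
  obtain ⟨L, hL⟩ := exists_set₂ (fun z w : 𝓜.Num =>
    (∃ x ≤ z, ∃ y ≤ w, z = pair 0 x ∧ w = pair 0 y ∧ pair x y ∈ (L₁ : Set 𝓜.Num)) ∨
    (∃ x ≤ z, ∃ y ≤ w, z = pair 0 x ∧ w = pair 1 y ∧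
      x ∈ (D₁ : Set 𝓜.Num) ∧ y ∈ (D₂ : Set 𝓜.Num)) ∨
    ∃ x ≤ z, ∃ y ≤ w, z = pair 1 x ∧ w = pair 1 y ∧ pair x y ∈ (L₂ : Set 𝓜.Num))
  have bd : ∀ (i z : 𝓜.Num) (P : 𝓜.Num → Prop),
      (∃ x ≤ z, z = pair i x ∧ P x) ↔ ∃ x, z = pair i x ∧ P x := by
    intro i z P
    refine exists_congr fun x => and_iff_right_of_imp ?_
    rintro ⟨rfl, -⟩
    exact right_le_pair i x
  have bd₂ : ∀ (i j z w : 𝓜.Num) (P : 𝓜.Num → 𝓜.Num → Prop),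
      (∃ x ≤ z, ∃ y ≤ w, z = pair i x ∧ w = pair j y ∧ P x y) ↔
        ∃ x y, z = pair i x ∧ w = pair j y ∧ P x y := by
    intro i j z w P
    constructor
    · rintro ⟨x, -, y, -, h⟩
      exact ⟨x, y, h⟩
    · rintro ⟨x, y, rfl, rfl, h⟩
      exact ⟨x, right_le_pair i x, y, right_le_pair j y, rfl, rfl, h⟩
  refine ⟨D, L, fun z => ?_, fun z w => ?_⟩
  · refine (hD z).trans ?_
    rw [bd, bd]
    rfl
  · refine (hL z w).trans ?_
    rw [bd₂, bd₂ 0 1, bd₂]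
    rfl

namespace IsSum

variable {X₁ X₂ X : OrderData 𝓜}

theorem dom_left (h : IsSum X₁ X₂ X) {x : 𝓜.Num} : X.dom (pair 0 x) ↔ X₁.dom x := by
  rw [h.dom_iff]; simp

theorem dom_right (h : IsSum X₁ X₂ X) {x : 𝓜.Num} : X.dom (pair 1 x) ↔ X₂.dom x := by
  rw [h.dom_iff]; simp

theorem lt_left (h : IsSum X₁ X₂ X) {x y : 𝓜.Num} : X.lt (pair 0 x) (pair 0 y) ↔ X₁.lt x y := by
  rw [h.lt_iff]; simp

theorem lt_right (h : IsSum X₁ X₂ X) {x y : 𝓜.Num} : X.lt (pair 1 x) (pair 1 y) ↔ X₂.lt x y := by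
  rw [h.lt_iff]; simp

theorem lt_left_right (h : IsSum X₁ X₂ X) {x y : 𝓜.Num} :
    X.lt (pair 0 x) (pair 1 y) ↔ X₁.dom x ∧ X₂.dom y := by
  rw [h.lt_iff]; simp

theorem not_lt_right_left (h : IsSum X₁ X₂ X) {x y : 𝓜.Num} : ¬ X.lt (pair 1 x) (pair 0 y) := by
  rw [h.lt_iff]; simp

theorem isLinear (h : IsSum X₁ X₂ X) (h₁ : X₁.IsLinear) (h₂ : X₂.IsLinear) : X.IsLinear where
  dom_of_lt z w hzw := by
    rw [h.lt_iff] at hzw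
    rcases hzw with ⟨x, y, rfl, rfl, hzw⟩ | ⟨x, y, rfl, rfl, hx, hy⟩ | ⟨x, y, rfl, rfl, hzw⟩
    · rw [h.dom_left, h.dom_left]
      exact h₁.dom_of_lt x y hzw
    · rw [h.dom_left, h.dom_right]
      exact ⟨hx, hy⟩
    · rw [h.dom_right, h.dom_right]
      exact h₂.dom_of_lt x y hzw
  irrefl z hz := by
    have hz' := hz
    rw [h.lt_iff] at hz'
    rcases hz' with ⟨x, y, rfl, -, -⟩ | ⟨x, y, rfl, e, -⟩ | ⟨x, y, rfl, -, -⟩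
    · exact h₁.irrefl x (h.lt_left.1 hz)
    · simp at e
    · exact h₂.irrefl x (h.lt_right.1 hz)
  trans z w v hzw hwv := by
    have hzw' := hzw
    have hwv' := hwv
    rw [h.lt_iff] at hzw' hwv'
    rcases hzw' with ⟨x, y, rfl, rfl, hxy⟩ | ⟨x, y, rfl, rfl, hx, hy⟩ | ⟨x, y, rfl, rfl, hxy⟩
    · rcases hwv' with ⟨y', x', e, rfl, hyx⟩ | ⟨y', x', e, rfl, hyx⟩ | ⟨y', x', e, rfl, hyx⟩
      · obtain rfl : y = y' := by simpa using e
        exact h.lt_left.2 (h₁.trans _ _ _ hxy hyx)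
      · exact h.lt_left_right.2 ⟨(h₁.dom_of_lt _ _ hxy).1, hyx.2⟩
      · simp at e
    · rcases hwv' with ⟨y', x', e, rfl, hyx⟩ | ⟨y', x', e, rfl, hyx⟩ | ⟨y', x', e, rfl, hyx⟩
      · simp at e
      · simp at e
      · exact h.lt_left_right.2 ⟨hx, (h₂.dom_of_lt _ _ hyx).2⟩
    · rcases hwv' with ⟨y', x', e, rfl, hyx⟩ | ⟨y', x', e, rfl, hyx⟩ | ⟨y', x', e, rfl, hyx⟩
      · simp at e
      · simp at e
      · obtain rfl : y = y' := by simpa using e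
        exact h.lt_right.2 (h₂.trans _ _ _ hxy hyx)
  total z w hz hw := by
    rw [h.dom_iff] at hz hw
    rcases hz with ⟨x, rfl, hx⟩ | ⟨x, rfl, hx⟩
    · rcases hw with ⟨y, rfl, hy⟩ | ⟨y, rfl, hy⟩
      · rw [h.lt_left, h.lt_left]
        simpa using h₁.total x y hx hy
      · exact Or.inl (h.lt_left_right.2 ⟨hx, hy⟩)
    · rcases hw with ⟨y, rfl, hy⟩ | ⟨y, rfl, hy⟩
      · exact Or.inr (Or.inr (h.lt_left_right.2 ⟨hy, hx⟩))
      · rw [h.lt_right, h.lt_right]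
        simpa using h₂.total x y hx hy

/-- Once a descending sequence enters the left summand it stays there, so a tail of it descends in
`X₁`. Otherwise the whole sequence lies in `X₂`. -/
theorem isWellFounded (h : IsSum X₁ X₂ X) (h₁ : X₁.IsWellFounded) (h₂ : X₂.IsWellFounded) :
    X.IsWellFounded := by
  rintro ⟨F, hF, tot, dom, desc⟩
  lift F to 𝓜.sets using hF
  have uniq : ∀ i x y, pair i x ∈ (F : Set 𝓜.Num) → pair i y ∈ (F : Set 𝓜.Num) → x = y :=
    fun i x y hx hy => (tot i).unique hx hy
  by_cases hl : ∃ k x, pair k (pair 0 x) ∈ (F : Set 𝓜.Num)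
  · obtain ⟨k, x₀, hx₀⟩ := hl
    refine h₁.false_of_descending (fun i x => pair (k + i) (pair 0 x) ∈ (F : Set 𝓜.Num)) ?_ ?_ ?_ ?_
    · refine sigma1_induction inferInstance ⟨x₀, by rwa [add_zero]⟩ ?_
      rintro i ⟨x, hx⟩
      obtain ⟨z, hz, -⟩ := tot (k + i + 1)
      have hz' := desc _ _ _ hx hz
      rcases (h.dom_iff z).1 (dom _ _ hz) with ⟨y, rfl, -⟩ | ⟨y, rfl, -⟩
      · exact ⟨y, by rwa [← add_assoc]⟩
      · exact (h.not_lt_right_left hz').elim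
    · intro i x y hx hy
      simpa using uniq _ _ _ hx hy
    · intro i x hx
      exact h.dom_left.1 (dom _ _ hx)
    · intro i x y hx hy
      rw [← add_assoc] at hy
      exact h.lt_left.1 (desc _ _ _ hx hy)
  · refine h₂.false_of_descending (fun i x => pair i (pair 1 x) ∈ (F : Set 𝓜.Num)) ?_ ?_ ?_ ?_
    · intro i
      obtain ⟨z, hz, -⟩ := tot i
      rcases (h.dom_iff z).1 (dom _ _ hz) with ⟨y, rfl, -⟩ | ⟨y, rfl, -⟩
      · exact absurd ⟨i, y, hz⟩ hl
      · exact ⟨y, hz⟩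
    · intro i x y hx hy
      simpa using uniq _ _ _ hx hy
    · intro i x hx
      exact h.dom_right.1 (dom _ _ hx)
    · intro i x y hx hy
      exact h.lt_right.1 (desc _ _ _ hx hy)

theorem isWellOrder (h : IsSum X₁ X₂ X) (h₁ : X₁.IsWellOrder) (h₂ : X₂.IsWellOrder) :
    X.IsWellOrder :=
  ⟨h.isLinear h₁.1 h₂.1, h.isWellFounded h₁.2 h₂.2⟩

end IsSum

end WellFounded

/-! ## Powers and Goodstein terms -/

section Terms

variable {𝓜 : L2Structure.{u}} [h𝓜 : Fact 𝓜.IsModelRCA0] {X Y : OrderData 𝓜}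

namespace L2Structure.OrderData

namespace IsOmegaPow

theorem dom_nil (h : X.IsOmegaPow Y) : Y.dom nil := (h.dom_iff _).2 (Or.inl rfl)

theorem dom_cons (h : X.IsOmegaPow Y) {a l : 𝓜.Num} : Y.dom (cons a l) ↔
    X.dom a ∧ Y.dom l ∧ ∀ b m, l = cons b m → X.lt b a ∨ b = a := by
  rw [h.dom_iff]
  simp only [cons_ne_nil, cons_inj, false_or]
  constructor
  · rintro ⟨a', l', ⟨rfl, rfl⟩, h⟩
    exact h
  · exact fun h => ⟨a, l, ⟨rfl, rfl⟩, h⟩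

theorem dom_singleton (h : X.IsOmegaPow Y) {a : 𝓜.Num} : Y.dom (cons a nil) ↔ X.dom a := by
  rw [h.dom_cons]
  simp [h.dom_nil]

theorem dom_cons_cons (h : X.IsOmegaPow Y) {a b m : 𝓜.Num} : Y.dom (cons a (cons b m)) ↔
    X.dom a ∧ Y.dom (cons b m) ∧ (X.lt b a ∨ b = a) := by
  rw [h.dom_cons]
  simp

theorem nil_lt_cons (h : X.IsOmegaPow Y) {a l : 𝓜.Num} : Y.lt nil (cons a l) ↔ Y.dom (cons a l) := by
  rw [h.lt_iff]
  simp [h.dom_nil]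

theorem not_lt_nil (h : X.IsOmegaPow Y) (s : 𝓜.Num) : ¬ Y.lt s nil := by
  rw [h.lt_iff]
  simp

theorem lt_cons_cons (h : X.IsOmegaPow Y) {a l b m : 𝓜.Num} : Y.lt (cons a l) (cons b m) ↔
    Y.dom (cons a l) ∧ Y.dom (cons b m) ∧ (X.lt a b ∨ a = b ∧ Y.lt l m) := by
  rw [h.lt_iff]
  refine and_congr_right fun _ => and_congr_right fun _ => ?_
  simp only [cons_ne_nil, cons_inj, false_and, false_or]
  constructor
  · rintro ⟨a', l', b', m', ⟨rfl, rfl⟩, ⟨rfl, rfl⟩, h⟩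
    exact h
  · exact fun h => ⟨a, l, b, m, ⟨rfl, rfl⟩, ⟨rfl, rfl⟩, h⟩

theorem singleton_lt_singleton (h : X.IsOmegaPow Y) {a b : 𝓜.Num} (ha : X.dom a) (hb : X.dom b)
    (hab : X.lt a b) : Y.lt (cons a nil) (cons b nil) :=
  h.lt_cons_cons.2 ⟨h.dom_singleton.2 ha, h.dom_singleton.2 hb, Or.inl hab⟩

end IsOmegaPow

namespace IsGoodstein

theorem dom_nil (h : X.IsGoodstein Y) : Y.dom nil := (h.dom_iff _).2 (Or.inl rfl)

theorem dom_cons (h : X.IsGoodstein Y) {γ δ ρ : 𝓜.Num} : Y.dom (cons (pair γ δ) ρ) ↔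
    Y.dom γ ∧ X.dom δ ∧ Y.dom ρ ∧ ∀ γ' δ' ρ', ρ = cons (pair γ' δ') ρ' → Y.lt γ' γ := by
  rw [h.dom_iff]
  simp only [cons_ne_nil, cons_inj, pair_inj, false_or]
  constructor
  · rintro ⟨γ', δ', ρ', ⟨⟨rfl, rfl⟩, rfl⟩, h⟩
    exact h
  · exact fun h => ⟨γ, δ, ρ, ⟨⟨rfl, rfl⟩, rfl⟩, h⟩

theorem dom_cases (h : X.IsGoodstein Y) {σ : 𝓜.Num} (hσ : Y.dom σ) :
    σ = nil ∨ ∃ γ δ ρ, σ = cons (pair γ δ) ρ := by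
  rcases (h.dom_iff σ).1 hσ with h | ⟨γ, δ, ρ, e, -⟩
  · exact Or.inl h
  · exact Or.inr ⟨γ, δ, ρ, e⟩

theorem dom_of_lt (h : X.IsGoodstein Y) {σ τ : 𝓜.Num} (hστ : Y.lt σ τ) : Y.dom σ ∧ Y.dom τ :=
  ⟨((h.lt_iff _ _).1 hστ).1, ((h.lt_iff _ _).1 hστ).2.1⟩

theorem nil_lt_cons (h : X.IsGoodstein Y) {a l : 𝓜.Num} : Y.lt nil (cons a l) ↔ Y.dom (cons a l) := by
  rw [h.lt_iff]
  simp [h.dom_nil]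

theorem not_lt_nil (h : X.IsGoodstein Y) (σ : 𝓜.Num) : ¬ Y.lt σ nil := by
  rw [h.lt_iff]
  simp

theorem lt_cons_cons (h : X.IsGoodstein Y) {γ δ ρ γ' δ' ρ' : 𝓜.Num} :
    Y.lt (cons (pair γ δ) ρ) (cons (pair γ' δ') ρ') ↔
      Y.dom (cons (pair γ δ) ρ) ∧ Y.dom (cons (pair γ' δ') ρ') ∧
        (Y.lt γ γ' ∨ γ = γ' ∧ (X.lt δ δ' ∨ δ = δ' ∧ Y.lt ρ ρ')) := by
  rw [h.lt_iff]
  refine and_congr_right fun _ => and_congr_right fun _ => ?_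
  simp only [cons_ne_nil, cons_inj, pair_inj, false_and, false_or]
  constructor
  · rintro ⟨_, _, _, _, _, _, ⟨⟨rfl, rfl⟩, rfl⟩, ⟨⟨rfl, rfl⟩, rfl⟩, h⟩
    exact h
  · exact fun h => ⟨_, _, _, _, _, _, ⟨⟨rfl, rfl⟩, rfl⟩, ⟨⟨rfl, rfl⟩, rfl⟩, h⟩

/-- Each property is proved by induction on the code of the first term, since the exponent `γ` and
the remainder `ρ` have smaller codes. With `E` and `K` as parameters the formulas are at most `Π⁰₁`.
-/
theorem isLinear {E K : 𝓜.sets} (h : X.IsGoodstein (codedOrder (E : Set 𝓜.Num) K))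
    (hX : X.IsLinear) : (codedOrder (E : Set 𝓜.Num) K).IsLinear := by
  set Y := codedOrder (E : Set 𝓜.Num) K with hY
  refine ⟨fun σ τ hστ => h.dom_of_lt hστ, ?_, ?_, ?_⟩
  · intro σ
    refine sigma1_strong_induction (P := fun σ => ¬ Y.lt σ σ) ?_ σ
    intro σ ih hσ
    rcases h.dom_cases (h.dom_of_lt hσ).1 with rfl | ⟨γ, δ, ρ, rfl⟩
    · exact h.not_lt_nil _ hσ
    · rw [h.lt_cons_cons] at hσ
      rcases hσ with ⟨-, -, h1 | ⟨-, h1 | ⟨-, h1⟩⟩⟩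
      · exact ih γ (by simp) h1
      · exact hX.irrefl δ h1
      · exact ih ρ (by simp) h1
  · intro σ
    refine pi1_strong_induction (P := fun σ => ∀ τ υ, Y.lt σ τ → Y.lt τ υ → Y.lt σ υ) ?_ σ
    intro σ ih τ υ h1 h2
    have dσ := (h.dom_of_lt h1).1
    have dυ := (h.dom_of_lt h2).2
    rcases h.dom_cases dυ with rfl | ⟨γ₂, δ₂, ρ₂, rfl⟩
    · exact (h.not_lt_nil _ h2).elim
    rcases h.dom_cases dσ with rfl | ⟨γ₀, δ₀, ρ₀, rfl⟩
    · exact h.nil_lt_cons.2 dυ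
    rcases h.dom_cases (h.dom_of_lt h1).2 with rfl | ⟨γ₁, δ₁, ρ₁, rfl⟩
    · exact (h.not_lt_nil _ h1).elim
    refine h.lt_cons_cons.2 ⟨dσ, dυ, ?_⟩
    have h1' := (h.lt_cons_cons.1 h1).2.2
    have h2' := (h.lt_cons_cons.1 h2).2.2
    rcases h1' with h1' | ⟨rfl, h1'⟩
    · rcases h2' with h2' | ⟨rfl, h2'⟩
      · exact Or.inl (ih γ₀ (by simp) _ _ h1' h2')
      · exact Or.inl h1'
    · rcases h2' with h2' | ⟨rfl, h2'⟩
      · exact Or.inl h2'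
      · refine Or.inr ⟨rfl, ?_⟩
        rcases h1' with h1' | ⟨rfl, h1'⟩
        · rcases h2' with h2' | ⟨rfl, h2'⟩
          · exact Or.inl (hX.trans _ _ _ h1' h2')
          · exact Or.inl h1'
        · rcases h2' with h2' | ⟨rfl, h2'⟩
          · exact Or.inl h2'
          · exact Or.inr ⟨rfl, ih ρ₀ (by simp) _ _ h1' h2'⟩
  · intro σ
    refine pi1_strong_induction
      (P := fun σ => ∀ τ, Y.dom σ → Y.dom τ → Y.lt σ τ ∨ σ = τ ∨ Y.lt τ σ) ?_ σ
    intro σ ih τ dσ dτ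
    rcases h.dom_cases dσ with rfl | ⟨γ, δ, ρ, rfl⟩
    · rcases h.dom_cases dτ with rfl | ⟨γ', δ', ρ', rfl⟩
      · exact Or.inr (Or.inl rfl)
      · exact Or.inl (h.nil_lt_cons.2 dτ)
    · rcases h.dom_cases dτ with rfl | ⟨γ', δ', ρ', rfl⟩
      · exact Or.inr (Or.inr (h.nil_lt_cons.2 dσ))
      · have e := h.dom_cons.1 dσ
        have e' := h.dom_cons.1 dτ
        rw [h.lt_cons_cons, h.lt_cons_cons]
        simp only [dσ, dτ, true_and, cons_inj, pair_inj]
        rcases ih γ (by simp) γ' e.1 e'.1 with h1 | rfl | h1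
        · exact Or.inl (Or.inl h1)
        · rcases hX.total δ δ' e.2.1 e'.2.1 with h1 | rfl | h1
          · exact Or.inl (Or.inr ⟨rfl, Or.inl h1⟩)
          · rcases ih ρ (by simp) ρ' e.2.2.1 e'.2.2.1 with h1 | rfl | h1
            · exact Or.inl (Or.inr ⟨rfl, Or.inr ⟨rfl, h1⟩⟩)
            · exact Or.inr (Or.inl ⟨⟨rfl, rfl⟩, rfl⟩)
            · exact Or.inr (Or.inr (Or.inr ⟨rfl, Or.inr ⟨rfl, h1⟩⟩))
          · exact Or.inr (Or.inr (Or.inr ⟨rfl, Or.inl h1⟩))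
        · exact Or.inr (Or.inr (Or.inl h1))

end IsGoodstein

end L2Structure.OrderData

end Terms

/-! ## Towers embed into values of the Goodstein predilator -/

section TowerToGoodstein

variable {𝓜 : L2Structure.{u}} [h𝓜 : Fact 𝓜.IsModelRCA0]

theorem eq_zero_or_eq_add_one (n : 𝓜.Num) : n = 0 ∨ ∃ k, n = k + 1 := by
  refine (eq_or_ne n 0).imp_right fun h => ?_
  obtain ⟨k, rfl⟩ := exists_add_of_le (Order.one_le_iff_pos.2 (pos_iff_ne_zero.2 h))
  exact ⟨k, add_comm _ _⟩

theorem add_one_ne_zero' (n : 𝓜.Num) : n + 1 ≠ 0 := h𝓜.out.add_one_ne_zero n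

theorem lt_add_one' (n : 𝓜.Num) : n < n + 1 := Order.lt_add_one_iff.2 le_rfl

/-- The ternary relation coded by the set `Z`. -/
def rel (Z : Set 𝓜.Num) (n x y : 𝓜.Num) : Prop := pair n (pair x y) ∈ Z

instance Delta0.rel {k : ℕ} (Z : 𝓜.sets) (s t u : (Fin k → 𝓜.Num) → 𝓜.Num) [TermDef s] [TermDef t]
    [TermDef u] : Delta0 (fun v => rel (Z : Set 𝓜.Num) (s v) (t v) (u v)) :=
  inferInstanceAs (Delta0 fun v => pair (s v) (pair (t v) (u v)) ∈ (Z : Set 𝓜.Num))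

/-- `Z` is the graph of the maps `ω^⟨n, X⟩ → G(ω + X)` which send `x ∈ X` to
`(1 + ω + X)^0 · (1 + x)`, and a sequence in which the entry `a` is repeated `c + 1` times to a
term with summand `(1 + ω + X)^γ · (1 + c)`, where `γ` is the value at `a`. -/
structure IsTowerMap (Z : Set 𝓜.Num) : Prop where
  zero_iff : ∀ x g, rel Z 0 x g ↔ g = cons (pair nil (pair 1 x)) nil
  cases : ∀ n x g, rel Z (n + 1) x g → x = nil ∨ ∃ a l, x = cons a l
  nil_iff : ∀ n g, rel Z (n + 1) nil g ↔ g = nil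
  cons_iff : ∀ n a l g, rel Z (n + 1) (cons a l) g ↔ ∃ γ h, rel Z n a γ ∧ rel Z (n + 1) l h ∧
    ((∃ m c ρ, l = cons a m ∧ h = cons (pair γ (pair 0 c)) ρ ∧
        g = cons (pair γ (pair 0 (c + 1))) ρ) ∨
      ((∀ m, l ≠ cons a m) ∧ g = cons (pair γ (pair 0 0)) h))

theorem exists_isTowerMap : ∃ Z : 𝓜.sets, IsTowerMap (Z : Set 𝓜.Num) := by
  obtain ⟨Z, hZ⟩ := exists_rel_recursion (𝓜 := 𝓜) (fun S n x g =>
    (n = 0 ∧ g = cons (pair nil (pair 1 x)) nil) ∨ ∃ k < n, n = k + 1 ∧ ((x = nil ∧ g = nil) ∨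
      ∃ a < x, ∃ l < x, x = cons a l ∧ ∃ γ ≤ g, ∃ h ≤ g, S k a γ ∧ S n l h ∧
        ((∃ m ≤ l, ∃ c ≤ g, ∃ ρ ≤ g, l = cons a m ∧ h = cons (pair γ (pair 0 c)) ρ ∧
          g = cons (pair γ (pair 0 (c + 1))) ρ) ∨
        ((∀ m ≤ l, l ≠ cons a m) ∧ g = cons (pair γ (pair 0 0)) h)))) inferInstance
  have hZ1 : ∀ n x g, rel (Z : Set 𝓜.Num) (n + 1) x g ↔ (x = nil ∧ g = nil) ∨
      ∃ a l, x = cons a l ∧ ∃ γ h, rel (Z : Set 𝓜.Num) n a γ ∧ rel (Z : Set 𝓜.Num) (n + 1) l h ∧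
        ((∃ m c ρ, l = cons a m ∧ h = cons (pair γ (pair 0 c)) ρ ∧
          g = cons (pair γ (pair 0 (c + 1))) ρ) ∨
        ((∀ m, l ≠ cons a m) ∧ g = cons (pair γ (pair 0 0)) h)) := by
    intro n x g
    refine (hZ _ _ _).trans ?_
    constructor
    · rintro (⟨h, -⟩ | ⟨k, -, e, h⟩)
      · exact absurd h (add_one_ne_zero' n)
      · obtain rfl := add_right_cancel e
        refine h.imp_right ?_
        rintro ⟨a, -, l, -, e, γ, -, h, -, h1, h2, h3⟩
        refine ⟨a, l, e, γ, h, h1.2.2.2, h2.2.2.2, ?_⟩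
        refine h3.imp ?_ ?_
        · rintro ⟨m, -, c, -, ρ, -, h⟩
          exact ⟨m, c, ρ, h⟩
        · rintro ⟨h4, h5⟩
          refine ⟨?_, h5⟩
          rintro m rfl
          exact h4 m (by simp) rfl
    · intro h
      refine Or.inr ⟨n, lt_add_one' n, rfl, h.imp_right ?_⟩
      rintro ⟨a, l, rfl, γ, h, h1, h2, h3⟩
      -- The recursion scheme admits earlier values only up to `g`. Raising a coefficient enlarges
      -- the code, so `h ≤ g` also when a repetition is merged.
      have hb : γ ≤ g ∧ h ≤ g := by
        rcases h3 with ⟨m, c, ρ, rfl, rfl, rfl⟩ | ⟨-, rfl⟩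
        · refine ⟨by simp, ?_⟩
          refine add_le_add_left (pair_le_pair (pair_le_pair le_rfl (pair_le_pair le_rfl ?_)) le_rfl) 1
          exact (lt_add_one' c).le
        · simp
      refine ⟨a, by simp, l, by simp, rfl, γ, hb.1, h, hb.2, ⟨(lt_add_one' n).le, by simp, hb.1, h1⟩,
        ⟨le_rfl, by simp, hb.2, h2⟩, h3.imp ?_ ?_⟩
      · rintro ⟨m, c, ρ, rfl, rfl, rfl⟩
        refine ⟨m, by simp, c, ?_, ρ, by simp, rfl, rfl, rfl⟩
        exact (lt_add_one' c).le.trans ((right_le_pair 0 _).trans (coeff_lt_cons _ _ _).le)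
      · rintro ⟨h4, h5⟩
        exact ⟨fun m _ => h4 m, h5⟩
  refine ⟨Z, ?_, ?_, ?_, ?_⟩
  · intro x g
    refine (hZ _ _ _).trans ?_
    simp [(add_one_ne_zero' _).symm]
  · intro n x g h
    rcases (hZ1 _ _ _).1 h with ⟨h, -⟩ | ⟨a, l, h, -⟩
    · exact Or.inl h
    · exact Or.inr ⟨a, l, h⟩
  · intro n g
    rw [hZ1]
    simp
  · intro n a l g
    rw [hZ1]
    simp only [cons_ne_nil, false_and, false_or, cons_inj]
    constructor
    · rintro ⟨a', l', ⟨rfl, rfl⟩, h⟩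
      exact h
    · exact fun h => ⟨a, l, ⟨rfl, rfl⟩, h⟩

namespace IsTowerMap

variable {Z : 𝓜.sets}

theorem unique (hZ : IsTowerMap (Z : Set 𝓜.Num)) {n x g g' : 𝓜.Num}
    (h : rel (Z : Set 𝓜.Num) n x g) (h' : rel (Z : Set 𝓜.Num) n x g') : g = g' := by
  refine pi1_strong_induction (P := fun x => ∀ n g g', rel (Z : Set 𝓜.Num) n x g →
    rel (Z : Set 𝓜.Num) n x g' → g = g') ?_ x n g g' h h'
  intro x ih n g g' h h'
  rcases eq_zero_or_eq_add_one n with rfl | ⟨n, rfl⟩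
  · rw [hZ.zero_iff] at h h'
    exact h.trans h'.symm
  · rcases hZ.cases _ _ _ h with rfl | ⟨a, l, rfl⟩
    · rw [hZ.nil_iff] at h h'
      exact h.trans h'.symm
    · rw [hZ.cons_iff] at h h'
      obtain ⟨γ, k, h1, h2, h3⟩ := h
      obtain ⟨γ', k', h1', h2', h3'⟩ := h'
      obtain rfl := ih a (by simp) _ _ _ h1 h1'
      obtain rfl := ih l (by simp) _ _ _ h2 h2'
      rcases h3 with ⟨m, c, ρ, rfl, rfl, rfl⟩ | ⟨h3, rfl⟩
      · rcases h3' with ⟨m', c', ρ', e, e', rfl⟩ | ⟨h3', -⟩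
        · simp only [cons_inj, pair_inj, true_and] at e'
          obtain ⟨rfl, rfl⟩ := e'
          rfl
        · exact absurd rfl (h3' m)
      · rcases h3' with ⟨m', c', ρ', e, -⟩ | ⟨-, rfl⟩
        · exact absurd e (h3 m')
        · rfl

/-- Whether or not repetitions are merged, the leading exponent is the image of the leading entry
and the leading coefficient lies in the copy of `ω`. -/
theorem head (hZ : IsTowerMap (Z : Set 𝓜.Num)) {n a l g : 𝓜.Num}
    (h : rel (Z : Set 𝓜.Num) (n + 1) (cons a l) g) :
    ∃ γ c ρ, g = cons (pair γ (pair 0 c)) ρ ∧ rel (Z : Set 𝓜.Num) n a γ := by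
  rw [hZ.cons_iff] at h
  obtain ⟨γ, k, h1, -, ⟨m, c, ρ, -, -, rfl⟩ | ⟨-, rfl⟩⟩ := h
  · exact ⟨γ, c + 1, ρ, rfl, h1⟩
  · exact ⟨γ, 0, k, rfl, h1⟩

theorem total (hZ : IsTowerMap (Z : Set 𝓜.Num)) {X : OrderData 𝓜} {T R : 𝓜.sets}
    (hT : IsTower X (T : Set 𝓜.Num) R) {n x : 𝓜.Num} (hx : (towerLevel (T : Set 𝓜.Num) R n).dom x) :
    ∃ g, rel (Z : Set 𝓜.Num) n x g := by
  -- Entries live one level lower, so the level must vary. Bounding it by `n` keeps the induction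
  -- formula `Σ⁰₁`.
  refine sigma1_strong_induction (P := fun x => ∀ k ≤ n,
    (towerLevel (T : Set 𝓜.Num) R k).dom x → ∃ g, rel (Z : Set 𝓜.Num) k x g) ?_ x n le_rfl hx
  clear hx x
  intro x ih k hk hx
  rcases eq_zero_or_eq_add_one k with rfl | ⟨k, rfl⟩
  · exact ⟨_, (hZ.zero_iff _ _).2 rfl⟩
  · rcases ((hT.succ k).dom_iff x).1 hx with rfl | ⟨a, l, rfl, ha, hl, -⟩
    · exact ⟨_, (hZ.nil_iff _ _).2 rfl⟩
    · obtain ⟨γ, hγ⟩ := ih a (by simp) k ((lt_add_one' k).le.trans hk) ha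
      obtain ⟨h, hh⟩ := ih l (by simp) (k + 1) hk hl
      simp only [hZ.cons_iff]
      by_cases hm : ∃ m, l = cons a m
      · obtain ⟨m, rfl⟩ := hm
        obtain ⟨γ', c, ρ, rfl, hγ'⟩ := hZ.head hh
        obtain rfl := hZ.unique hγ hγ'
        exact ⟨_, γ, _, hγ, hh, Or.inl ⟨m, c, ρ, rfl, rfl, rfl⟩⟩
      · exact ⟨_, γ, _, hγ, hh, Or.inr ⟨fun m e => hm ⟨m, e⟩, rfl⟩⟩

end IsTowerMap

/-- The outer induction is on the level, the inner ones on the code of the sequence. Being a term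
and monotonicity go together: exponents of an image must decrease strictly, which follows from
monotonicity one level below once repetitions have been merged. -/
theorem IsTowerMap.strictMono {X W Y : OrderData 𝓜} {T R E K Z : 𝓜.sets}
    (hZ : IsTowerMap (Z : Set 𝓜.Num)) (hT : IsTower X (T : Set 𝓜.Num) R)
    (hW : ∀ x, W.dom x) (hWlt : ∀ x y, W.lt x y ↔ x < y) (hY : IsSum W X Y)
    (hG : Y.IsGoodstein (codedOrder (E : Set 𝓜.Num) K))
    (hlin : (codedOrder (E : Set 𝓜.Num) K).IsLinear) (n : 𝓜.Num) :
    ∀ x y g h, (towerLevel (T : Set 𝓜.Num) R n).dom x → (towerLevel (T : Set 𝓜.Num) R n).dom y →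
      rel (Z : Set 𝓜.Num) n x g → rel (Z : Set 𝓜.Num) n y h →
      (codedOrder (E : Set 𝓜.Num) K).dom g ∧
      ((towerLevel (T : Set 𝓜.Num) R n).lt x y → (codedOrder (E : Set 𝓜.Num) K).lt g h) := by
  refine pi1_induction (P := fun n => ∀ x y g h, (towerLevel (T : Set 𝓜.Num) R n).dom x →
      (towerLevel (T : Set 𝓜.Num) R n).dom y →
      rel (Z : Set 𝓜.Num) n x g → rel (Z : Set 𝓜.Num) n y h →
      (codedOrder (E : Set 𝓜.Num) K).dom g ∧
      ((towerLevel (T : Set 𝓜.Num) R n).lt x y → (codedOrder (E : Set 𝓜.Num) K).lt g h)) ?_ ?_ n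
  · intro x y g h hx hy hg hh
    rw [hT.dom_zero] at hx hy
    rw [hZ.zero_iff] at hg hh
    subst hg hh
    have dom : ∀ x, X.dom x →
        (codedOrder (E : Set 𝓜.Num) K).dom (cons (pair nil (pair 1 x)) nil) := by
      intro x hx
      refine hG.dom_cons.2 ⟨hG.dom_nil, hY.dom_right.2 hx, hG.dom_nil, ?_⟩
      intro γ δ ρ e
      exact absurd e (nil_ne_cons _ _)
    refine ⟨dom x hx, fun hxy => ?_⟩
    rw [hT.lt_zero] at hxy
    exact hG.lt_cons_cons.2 ⟨dom x hx, dom y hy, Or.inr ⟨rfl, Or.inl (hY.lt_right.2 hxy)⟩⟩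
  · intro n ih
    have hS := hT.succ n
    have dom : ∀ x g, (towerLevel (T : Set 𝓜.Num) R (n + 1)).dom x →
        rel (Z : Set 𝓜.Num) (n + 1) x g → (codedOrder (E : Set 𝓜.Num) K).dom g := by
      intro x
      refine pi1_strong_induction (P := fun x => ∀ g,
        (towerLevel (T : Set 𝓜.Num) R (n + 1)).dom x → rel (Z : Set 𝓜.Num) (n + 1) x g →
        (codedOrder (E : Set 𝓜.Num) K).dom g) ?_ x
      intro x ihx g hx hg
      rcases hZ.cases _ _ _ hg with rfl | ⟨a, l, rfl⟩
      · rw [hZ.nil_iff] at hg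
        exact hg ▸ hG.dom_nil
      · obtain ⟨ha, hl, hal⟩ := hS.dom_cons.1 hx
        obtain ⟨γ, h, hγ, hh, hc⟩ := (hZ.cons_iff _ _ _ _).1 hg
        have dh := ihx l (by simp) h hl hh
        rcases hc with ⟨m, c, ρ, rfl, rfl, rfl⟩ | ⟨hm, rfl⟩
        · rw [hG.dom_cons] at dh ⊢
          exact ⟨dh.1, hY.dom_left.2 (hW _), dh.2.2⟩
        · refine hG.dom_cons.2 ⟨(ih a a γ γ ha ha hγ hγ).1, hY.dom_left.2 (hW _), dh, ?_⟩
          rintro γ' δ' ρ' rfl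
          rcases hZ.cases _ _ _ hh with rfl | ⟨b, m, rfl⟩
          · rw [hZ.nil_iff] at hh
            exact absurd hh (cons_ne_nil _ _)
          · obtain ⟨γ'', c, ρ, e, hb⟩ := hZ.head hh
            simp only [cons_inj, pair_inj] at e
            obtain ⟨⟨rfl, rfl⟩, rfl⟩ := e
            have hba : (towerLevel (T : Set 𝓜.Num) R n).lt b a := by
              rcases hal b m rfl with h | rfl
              · exact h
              · exact absurd rfl (hm m)
            exact (ih b a _ _ (hS.dom_cons.1 hl).1 ha hb hγ).2 hba
    intro x y g h hx hy hg hh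
    refine ⟨dom x g hx hg, ?_⟩
    refine pi1_strong_induction (P := fun x => ∀ y g h,
      (towerLevel (T : Set 𝓜.Num) R (n + 1)).dom x → (towerLevel (T : Set 𝓜.Num) R (n + 1)).dom y →
      rel (Z : Set 𝓜.Num) (n + 1) x g → rel (Z : Set 𝓜.Num) (n + 1) y h →
      (towerLevel (T : Set 𝓜.Num) R (n + 1)).lt x y →
      (codedOrder (E : Set 𝓜.Num) K).lt g h) ?_ x y g h hx hy hg hh
    clear hx hy hg hh x y g h
    intro x ihx y g h hx hy hg hh hxy
    have dg := dom x g hx hg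
    have dh := dom y h hy hh
    rcases hZ.cases _ _ _ hh with rfl | ⟨b, m, rfl⟩
    · exact (hS.not_lt_nil _ hxy).elim
    rcases hZ.cases _ _ _ hg with rfl | ⟨a, l, rfl⟩
    · rw [hZ.nil_iff] at hg
      subst hg
      obtain ⟨γ, c, ρ, rfl, -⟩ := hZ.head hh
      exact hG.nil_lt_cons.2 dh
    obtain ⟨ha, hl, hal⟩ := hS.dom_cons.1 hx
    obtain ⟨hb, hm, hbm⟩ := hS.dom_cons.1 hy
    rcases (hS.lt_cons_cons.1 hxy).2.2 with hab | ⟨rfl, hlm⟩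
    · obtain ⟨γ, c, ρ, rfl, hγ⟩ := hZ.head hg
      obtain ⟨γ', c', ρ', rfl, hγ'⟩ := hZ.head hh
      exact hG.lt_cons_cons.2 ⟨dg, dh, Or.inl ((ih _ _ _ _ ha hb hγ hγ').2 hab)⟩
    · obtain ⟨γ, g₁, hγ, hg₁, cg⟩ := (hZ.cons_iff _ _ _ _).1 hg
      obtain ⟨γ', h₁, hγ', hh₁, ch⟩ := (hZ.cons_iff _ _ _ _).1 hh
      obtain rfl := hZ.unique hγ hγ'
      have key := ihx l (by simp) m g₁ h₁ hl hm hg₁ hh₁ hlm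
      rcases cg with ⟨l', c, ρ, rfl, rfl, rfl⟩ | ⟨hl', rfl⟩
      · rcases ch with ⟨m', c', ρ', rfl, rfl, rfl⟩ | ⟨hm', rfl⟩
        -- Both tails start with `a`: the comparison of their images persists when both leading
        -- coefficients are raised by one.
        · refine hG.lt_cons_cons.2 ⟨dg, dh, Or.inr ⟨rfl, ?_⟩⟩
          rcases (hG.lt_cons_cons.1 key).2.2 with h | ⟨-, h | ⟨e, h⟩⟩
          · exact (hlin.irrefl _ h).elim
          · refine Or.inl ?_
            rw [hY.lt_left, hWlt] at h ⊢
            exact (add_lt_add_iff_right 1).2 h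
          · simp only [pair_inj, true_and] at e
            subst e
            exact Or.inr ⟨rfl, h⟩
        -- If `l` starts with `a` and `m` does not, then `m` is empty or starts with some `b` below
        -- `a`, which contradicts `l < m`.
        · exfalso
          rcases hZ.cases _ _ _ hh₁ with rfl | ⟨b, m', rfl⟩
          · exact hS.not_lt_nil _ hlm
          · obtain ⟨γ', c', ρ', rfl, hb'⟩ := hZ.head hh₁
            have hdb := (hS.dom_cons.1 hm).1
            have h1 : (towerLevel (T : Set 𝓜.Num) R n).lt b a := by
              rcases hbm b m' rfl with h | rfl
              · exact h
              · exact absurd rfl (hm' m')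
            have h2 : (towerLevel (T : Set 𝓜.Num) R n).lt a b := by
              rcases (hS.lt_cons_cons.1 hlm).2.2 with h | ⟨rfl, -⟩
              · exact h
              · exact absurd rfl (hm' m')
            -- Linearity of the tower levels is not at hand, so `b < a` and `a < b` are transported
            -- to the order of Goodstein terms, which is linear.
            have h3 := (ih b a _ _ hdb ha hb' hγ).2 h1
            have h4 := (ih a b _ _ ha hdb hγ hb').2 h2
            exact hlin.irrefl _ (hlin.trans _ _ _ h3 h4)
      · rcases ch with ⟨m', c', ρ', rfl, rfl, rfl⟩ | ⟨hm', rfl⟩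
        -- Here `a` is repeated only in `y`, so the leading coefficients are `0` and `c' + 1`.
        · refine hG.lt_cons_cons.2 ⟨dg, dh, Or.inr ⟨rfl, Or.inl ?_⟩⟩
          rw [hY.lt_left, hWlt]
          exact (zero_le).trans_lt (lt_add_one' c')
        · exact hG.lt_cons_cons.2 ⟨dg, dh, Or.inr ⟨rfl, Or.inr ⟨rfl, key⟩⟩⟩

/-- Composing a descending sequence in level `n` with the tower map yields one in `G(ω + X)` with a
`Σ⁰₁` graph. -/
theorem acaPrime_of_goodsteinIsDilator (h : 𝓜.GoodsteinIsDilator) : 𝓜.ACAPrime := by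
  intro D hD L hL hX
  lift D to 𝓜.sets using hD
  lift L to 𝓜.sets using hL
  refine ⟨?_, ?_⟩
  · obtain ⟨T, R, hT⟩ := exists_isTower D L hX.1
    exact ⟨T, T.2, R, R.2, hT⟩
  · intro T hTs R hRs hT n
    lift T to 𝓜.sets using hTs
    lift R to 𝓜.sets using hRs
    obtain ⟨DW, LW, hW, hWdom, hWlt⟩ := exists_omega (𝓜 := 𝓜)
    obtain ⟨DY, LY, hY⟩ := exists_isSum DW LW D L
    obtain ⟨E, K, hG⟩ := exists_isGoodstein DY LY
    obtain ⟨Z, hZ⟩ := exists_isTowerMap (𝓜 := 𝓜)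
    have hGW := (h DY DY.2 LY LY.2 (hY.isWellOrder hW hX)).2 E E.2 K K.2 hG
    have mono := hZ.strictMono hT hWdom hWlt hY hG hGW.1 n
    rintro ⟨F, hF, tot, dom, desc⟩
    lift F to 𝓜.sets using hF
    refine hGW.2.false_of_descending
      (fun i g => ∃ x, pair i x ∈ (F : Set 𝓜.Num) ∧ rel (Z : Set 𝓜.Num) n x g) ?_ ?_ ?_ ?_
    · intro i
      obtain ⟨x, hx, -⟩ := tot i
      obtain ⟨g, hg⟩ := hZ.total hT (dom i x hx)
      exact ⟨g, x, hx, hg⟩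
    · rintro i g g' ⟨x, hx, hg⟩ ⟨x', hx', hg'⟩
      obtain rfl := (tot i).unique hx hx'
      exact hZ.unique hg hg'
    · rintro i g ⟨x, hx, hg⟩
      exact (mono x x g g (dom i x hx) (dom i x hx) hg hg).1
    · rintro i g g' ⟨x, hx, hg⟩ ⟨x', hx', hg'⟩
      exact (mono x' x g' g (dom _ _ hx') (dom i x hx) hg' hg).2 (desc i x x' hx hx')

end TowerToGoodstein

/-! ## Values of the Goodstein predilator embed into towers -/

section GoodsteinToTower

variable {𝓜 : L2Structure.{u}} [h𝓜 : Fact 𝓜.IsModelRCA0]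

/-- `J` is the graph of the maps `Z → ω^⟨k, Z⟩` which iterate the formation of singletons; the value
is the middle component. -/
structure IsSingletonMap (J : Set 𝓜.Num) : Prop where
  zero_iff : ∀ w z, rel J 0 w z ↔ w = z
  succ_iff : ∀ k w z, rel J (k + 1) w z ↔ ∃ w', w = cons w' nil ∧ rel J k w' z

theorem exists_isSingletonMap : ∃ J : 𝓜.sets, IsSingletonMap (J : Set 𝓜.Num) := by
  -- The value `w` occupies the middle place because that component has to drop in the recursion,
  -- while the argument `z` stays fixed.
  obtain ⟨J, hJ⟩ := exists_rel_recursion (𝓜 := 𝓜) (fun S k w z => (k = 0 ∧ w = z) ∨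
    ∃ j < k, k = j + 1 ∧ ∃ w' < w, w = cons w' nil ∧ S j w' z) inferInstance
  refine ⟨J, fun w z => (hJ _ _ _).trans ?_, fun k w z => (hJ _ _ _).trans ?_⟩
  · simp [(add_one_ne_zero' _).symm]
  · constructor
    · rintro (⟨h, -⟩ | ⟨j, -, e, w', -, e', h⟩)
      · exact absurd h (add_one_ne_zero' k)
      · obtain rfl := add_right_cancel e
        exact ⟨w', e', h.2.2.2⟩
    · rintro ⟨w', rfl, h⟩
      exact Or.inr ⟨k, lt_add_one' k, rfl, w', by simp, rfl, (lt_add_one' k).le, by simp, le_rfl, h⟩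

namespace IsSingletonMap

variable {J : 𝓜.sets}

theorem total (hJ : IsSingletonMap (J : Set 𝓜.Num)) (k z : 𝓜.Num) :
    ∃ w, rel (J : Set 𝓜.Num) k w z := by
  refine sigma1_induction (P := fun k => ∃ w, rel (J : Set 𝓜.Num) k w z) inferInstance ?_ ?_ k
  · exact ⟨z, (hJ.zero_iff _ _).2 rfl⟩
  · rintro k ⟨w, hw⟩
    exact ⟨_, (hJ.succ_iff _ _ _).2 ⟨w, rfl, hw⟩⟩

theorem unique (hJ : IsSingletonMap (J : Set 𝓜.Num)) {k z w w' : 𝓜.Num}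
    (h : rel (J : Set 𝓜.Num) k w z) (h' : rel (J : Set 𝓜.Num) k w' z) : w = w' := by
  refine pi1_induction (P := fun k => ∀ w w', rel (J : Set 𝓜.Num) k w z →
    rel (J : Set 𝓜.Num) k w' z → w = w') ?_ ?_ k w w' h h'
  · intro w w' h h'
    rw [hJ.zero_iff] at h h'
    exact h.trans h'.symm
  · intro k ih w w' h h'
    rw [hJ.succ_iff] at h h'
    obtain ⟨v, rfl, h⟩ := h
    obtain ⟨v', rfl, h'⟩ := h'
    rw [ih v v' h h']

theorem strictMono (hJ : IsSingletonMap (J : Set 𝓜.Num)) {DZ LZ T R : 𝓜.sets}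
    (hT : IsTower (codedOrder (DZ : Set 𝓜.Num) LZ) (T : Set 𝓜.Num) R) (k : 𝓜.Num) :
    ∀ z z' w w', (codedOrder (DZ : Set 𝓜.Num) LZ).dom z → (codedOrder (DZ : Set 𝓜.Num) LZ).dom z' →
      rel (J : Set 𝓜.Num) k w z → rel (J : Set 𝓜.Num) k w' z' →
      (towerLevel (T : Set 𝓜.Num) R k).dom w ∧ ((codedOrder (DZ : Set 𝓜.Num) LZ).lt z z' →
        (towerLevel (T : Set 𝓜.Num) R k).lt w w') := by
  refine pi1_induction (P := fun k => ∀ z z' w w', (codedOrder (DZ : Set 𝓜.Num) LZ).dom z →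
      (codedOrder (DZ : Set 𝓜.Num) LZ).dom z' →
      rel (J : Set 𝓜.Num) k w z → rel (J : Set 𝓜.Num) k w' z' →
      (towerLevel (T : Set 𝓜.Num) R k).dom w ∧ ((codedOrder (DZ : Set 𝓜.Num) LZ).lt z z' →
        (towerLevel (T : Set 𝓜.Num) R k).lt w w')) ?_ ?_ k
  · intro z z' w w' hz hz' h h'
    rw [hJ.zero_iff] at h h'
    subst h h'
    rw [hT.dom_zero, hT.lt_zero]
    exact ⟨hz, id⟩
  · intro k ih z z' w w' hz hz' h h'
    rw [hJ.succ_iff] at h h'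
    obtain ⟨v, rfl, h⟩ := h
    obtain ⟨v', rfl, h'⟩ := h'
    obtain ⟨hv, hlt⟩ := ih z z' v v' hz hz' h h'
    refine ⟨(hT.succ k).dom_singleton.2 hv, fun hzz => ?_⟩
    exact (hT.succ k).singleton_lt_singleton hv (ih z' z' v' v' hz' hz' h' h').1 (hlt hzz)

end IsSingletonMap

/-- `H` consists of the pairs of a number `n` and a term in which exponents are nested at most
`n` times. -/
structure IsHeight (H : Set 𝓜.Num) : Prop where
  nil_mem : ∀ n, pair n nil ∈ H
  zero_cons : ∀ a l, pair 0 (cons a l) ∉ H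
  succ_cons_iff : ∀ n γ δ ρ, pair (n + 1) (cons (pair γ δ) ρ) ∈ H ↔
    pair n γ ∈ H ∧ pair (n + 1) ρ ∈ H

theorem exists_isHeight : ∃ H : 𝓜.sets, IsHeight (H : Set 𝓜.Num) := by
  obtain ⟨B, hB⟩ := exists_rel_recursion (𝓜 := 𝓜) (fun S n σ b => σ = nil ∨
    ∃ k < n, n = k + 1 ∧ ∃ γ < σ, ∃ δ < σ, ∃ ρ < σ, σ = cons (pair γ δ) ρ ∧ S k γ b ∧ S n ρ b)
    inferInstance
  obtain ⟨H, hH⟩ := exists_set₂ (fun n σ : 𝓜.Num => pair n (pair σ 0) ∈ (B : Set 𝓜.Num))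
  refine ⟨H, ?_, ?_, ?_⟩
  · intro n
    rw [hH, hB]
    exact Or.inl rfl
  · intro a l
    rw [hH, hB]
    simp
  · intro n γ δ ρ
    rw [hH, hH, hH, hB]
    constructor
    · rintro (h | ⟨k, -, e, γ', -, δ', -, ρ', -, e', h1, h2⟩)
      · exact absurd h (cons_ne_nil _ _)
      · obtain rfl := add_right_cancel e
        simp only [cons_inj, pair_inj] at e'
        obtain ⟨⟨rfl, rfl⟩, rfl⟩ := e'
        exact ⟨h1.2.2.2, h2.2.2.2⟩
    · rintro ⟨h1, h2⟩
      exact Or.inr ⟨n, lt_add_one' n, rfl, γ, by simp, δ, by simp, ρ, by simp, rfl,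
        ⟨(lt_add_one' n).le, by simp, le_rfl, h1⟩, ⟨le_rfl, by simp, le_rfl, h2⟩⟩

namespace IsHeight

variable {H E K : 𝓜.sets} {X : OrderData 𝓜}

/-- Passing to an exponent lowers the code, so exponents cannot be nested more often than the code
of the term allows. -/
theorem mem_of_le (hH : IsHeight (H : Set 𝓜.Num)) (hG : X.IsGoodstein (codedOrder (E : Set 𝓜.Num) K))
    {n σ : 𝓜.Num} (h : σ ≤ n) (hσ : (codedOrder (E : Set 𝓜.Num) K).dom σ) :
    pair n σ ∈ (H : Set 𝓜.Num) := by
  refine pi1_strong_induction (P := fun σ => ∀ n, σ ≤ n →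
    (codedOrder (E : Set 𝓜.Num) K).dom σ → pair n σ ∈ (H : Set 𝓜.Num)) ?_ σ n h hσ
  intro σ ih n h hσ
  rcases hG.dom_cases hσ with rfl | ⟨γ, δ, ρ, rfl⟩
  · exact hH.nil_mem n
  · have e := hG.dom_cons.1 hσ
    rcases eq_zero_or_eq_add_one n with rfl | ⟨n, rfl⟩
    · exact absurd ((exp_lt_cons γ δ ρ).trans_le h) not_lt_zero
    · refine (hH.succ_cons_iff _ _ _ _).2 ⟨ih γ (by simp) n ?_ e.1, ih ρ (by simp) _ ?_ e.2.2.1⟩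
      · exact Order.lt_add_one_iff.1 ((exp_lt_cons γ δ ρ).trans_le h)
      · exact (tail_lt_cons _ _).le.trans h

/-- The leading exponent of `τ` is at most that of `σ`. The remainder of `τ` lies below `τ`, since
exponents decrease, hence below `σ`. Induction on the code of `τ` applies to both. -/
theorem mem_of_lt (hH : IsHeight (H : Set 𝓜.Num)) (hG : X.IsGoodstein (codedOrder (E : Set 𝓜.Num) K))
    (hlin : (codedOrder (E : Set 𝓜.Num) K).IsLinear) {n σ τ : 𝓜.Num}
    (h : (codedOrder (E : Set 𝓜.Num) K).lt τ σ) (hσ : pair n σ ∈ (H : Set 𝓜.Num)) :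
    pair n τ ∈ (H : Set 𝓜.Num) := by
  refine pi1_strong_induction (P := fun τ => ∀ n σ, (codedOrder (E : Set 𝓜.Num) K).lt τ σ →
    pair n σ ∈ (H : Set 𝓜.Num) → pair n τ ∈ (H : Set 𝓜.Num)) ?_ τ n σ h hσ
  intro τ ih n σ h hσ
  have dτ := (hG.dom_of_lt h).1
  rcases hG.dom_cases dτ with rfl | ⟨γ, δ, ρ, rfl⟩
  · exact hH.nil_mem n
  · rcases hG.dom_cases (hG.dom_of_lt h).2 with rfl | ⟨γ', δ', ρ', rfl⟩
    · exact (hG.not_lt_nil _ h).elim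
    · rcases eq_zero_or_eq_add_one n with rfl | ⟨n, rfl⟩
      · exact absurd hσ (hH.zero_cons _ _)
      · have hσ' := (hH.succ_cons_iff _ _ _ _).1 hσ
        have e := hG.dom_cons.1 dτ
        refine (hH.succ_cons_iff _ _ _ _).2 ⟨?_, ?_⟩
        · rcases (hG.lt_cons_cons.1 h).2.2 with h' | ⟨rfl, -⟩
          · exact ih γ (by simp) _ _ h' hσ'.1
          · exact hσ'.1
        · refine ih ρ (by simp) _ _ (hlin.trans _ _ _ ?_ h) hσ
          rcases hG.dom_cases e.2.2.1 with rfl | ⟨γ₁, δ₁, ρ₁, rfl⟩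
          · exact hG.nil_lt_cons.2 dτ
          · exact hG.lt_cons_cons.2 ⟨e.2.2.1, dτ, Or.inl (e.2.2.2 _ _ _ rfl)⟩

end IsHeight

/-- `Q` is the graph of the maps that send terms of height at most `n` to `ω^⟨2n, Z⟩`, where `Z`
extends `X` by a top element: a summand `(1 + X)^γ · (1 + δ)` becomes the sequence of length two
with entries the value at `γ` and the iterated singleton of `δ`. -/
structure IsTermMap (J : Set 𝓜.Num) (top : 𝓜.Num) (Q : Set 𝓜.Num) : Prop where
  nil_iff : ∀ n v, rel Q n nil v ↔ rel J (n + n) v top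
  zero_cons : ∀ a l v, ¬ rel Q 0 (cons a l) v
  succ_cons_iff : ∀ n γ δ ρ v, rel Q (n + 1) (cons (pair γ δ) ρ) v ↔
    ∃ u w v', v = cons (cons u (cons w nil)) v' ∧ rel Q n γ u ∧ rel J (n + n) w (pair 0 δ) ∧
      rel Q (n + 1) ρ v'

theorem exists_isTermMap (J : 𝓜.sets) (top : 𝓜.Num) :
    ∃ Q : 𝓜.sets, IsTermMap (J : Set 𝓜.Num) top Q := by
  obtain ⟨Q, hQ⟩ := exists_rel_recursion (𝓜 := 𝓜) (fun S n σ v =>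
    (σ = nil ∧ rel (J : Set 𝓜.Num) (n + n) v top) ∨ ∃ k < n, n = k + 1 ∧
    ∃ γ < σ, ∃ δ < σ, ∃ ρ < σ, σ = cons (pair γ δ) ρ ∧ ∃ u < v, ∃ w < v, ∃ v' < v,
      v = cons (cons u (cons w nil)) v' ∧ S k γ u ∧ rel (J : Set 𝓜.Num) (k + k) w (pair 0 δ) ∧
      S n ρ v') inferInstance
  refine ⟨Q, fun n v => (hQ _ _ _).trans ?_, fun a l v h => ?_, fun n γ δ ρ v => (hQ _ _ _).trans ?_⟩
  · simp
  · have h' := (hQ _ _ _).1 h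
    simp at h'
  · constructor
    · rintro (⟨h, -⟩ | ⟨k, -, e, γ', -, δ', -, ρ', -, e', u, -, w, -, v', -, rfl, h1, h2, h3⟩)
      · exact absurd h (cons_ne_nil _ _)
      · obtain rfl := add_right_cancel e
        simp only [cons_inj, pair_inj] at e'
        obtain ⟨⟨rfl, rfl⟩, rfl⟩ := e'
        exact ⟨u, w, v', rfl, h1.2.2.2, h2, h3.2.2.2⟩
    · rintro ⟨u, w, v', rfl, h1, h2, h3⟩
      have hu : u < cons (cons u (cons w nil)) v' := (head_lt_cons _ _).trans (head_lt_cons _ _)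
      have hw : w < cons (cons u (cons w nil)) v' :=
        (head_lt_cons _ _).trans ((tail_lt_cons _ _).trans (head_lt_cons _ _))
      exact Or.inr ⟨n, lt_add_one' n, rfl, γ, by simp, δ, by simp, ρ, by simp, rfl, u, hu, w, hw, v',
        by simp, rfl, ⟨(lt_add_one' n).le, by simp, hu.le, h1⟩, h2, ⟨le_rfl, by simp, by simp, h3⟩⟩

namespace IsTermMap

variable {J Q E K : 𝓜.sets} {X : OrderData 𝓜} {top : 𝓜.Num}

theorem unique (hQ : IsTermMap (J : Set 𝓜.Num) top Q) (hJ : IsSingletonMap (J : Set 𝓜.Num))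
    (hG : X.IsGoodstein (codedOrder (E : Set 𝓜.Num) K)) {n σ v v' : 𝓜.Num}
    (hσ : (codedOrder (E : Set 𝓜.Num) K).dom σ)
    (h : rel (Q : Set 𝓜.Num) n σ v) (h' : rel (Q : Set 𝓜.Num) n σ v') : v = v' := by
  refine pi1_strong_induction (P := fun σ => ∀ n v v', (codedOrder (E : Set 𝓜.Num) K).dom σ →
    rel (Q : Set 𝓜.Num) n σ v → rel (Q : Set 𝓜.Num) n σ v' → v = v') ?_ σ n v v' hσ h h'
  intro σ ih n v v' hσ h h'
  rcases hG.dom_cases hσ with rfl | ⟨γ, δ, ρ, rfl⟩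
  · rw [hQ.nil_iff] at h h'
    exact hJ.unique h h'
  · rcases eq_zero_or_eq_add_one n with rfl | ⟨n, rfl⟩
    · exact (hQ.zero_cons _ _ _ h).elim
    · have e := hG.dom_cons.1 hσ
      rw [hQ.succ_cons_iff] at h h'
      obtain ⟨u, w, v, rfl, h1, h2, h3⟩ := h
      obtain ⟨u', w', v', rfl, h1', h2', h3'⟩ := h'
      rw [ih γ (by simp) _ _ _ e.1 h1 h1', hJ.unique h2 h2', ih ρ (by simp) _ _ _ e.2.2.1 h3 h3']

theorem total (hQ : IsTermMap (J : Set 𝓜.Num) top Q) (hJ : IsSingletonMap (J : Set 𝓜.Num))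
    (hG : X.IsGoodstein (codedOrder (E : Set 𝓜.Num) K)) {H : 𝓜.sets} (hH : IsHeight (H : Set 𝓜.Num))
    {n σ : 𝓜.Num} (hσ : (codedOrder (E : Set 𝓜.Num) K).dom σ) (h : pair n σ ∈ (H : Set 𝓜.Num)) :
    ∃ v, rel (Q : Set 𝓜.Num) n σ v := by
  refine sigma1_strong_induction (P := fun σ => ∀ k ≤ n, (codedOrder (E : Set 𝓜.Num) K).dom σ →
    pair k σ ∈ (H : Set 𝓜.Num) → ∃ v, rel (Q : Set 𝓜.Num) k σ v) ?_ σ n le_rfl hσ h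
  clear hσ h σ
  intro σ ih k hk hσ h
  rcases hG.dom_cases hσ with rfl | ⟨γ, δ, ρ, rfl⟩
  · simp only [hQ.nil_iff]
    exact hJ.total _ _
  · rcases eq_zero_or_eq_add_one k with rfl | ⟨k, rfl⟩
    · exact (hH.zero_cons _ _ h).elim
    · have e := hG.dom_cons.1 hσ
      rw [hH.succ_cons_iff] at h
      obtain ⟨u, hu⟩ := ih γ (by simp) k ((lt_add_one' k).le.trans hk) e.1 h.1
      obtain ⟨v, hv⟩ := ih ρ (by simp) _ hk e.2.2.1 h.2
      obtain ⟨w, hw⟩ := hJ.total (k + k) (pair 0 δ)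
      exact ⟨_, (hQ.succ_cons_iff _ _ _ _ _).2 ⟨u, w, v, rfl, hu, hw, hv⟩⟩

/-- The two middle conjuncts say that every value is at least the image of the top element and
exceeds the images of all `z` below it. They strengthen the induction on `n` so that `⟨u, w⟩` is
non-increasing: `w` is the image of a coefficient, which is below the top element. This is why `X`
is extended by a top and why the empty term goes to its image. -/
theorem strictMono (hQ : IsTermMap (J : Set 𝓜.Num) top Q) (hJ : IsSingletonMap (J : Set 𝓜.Num))
    (hG : X.IsGoodstein (codedOrder (E : Set 𝓜.Num) K)) {DZ LZ T R : 𝓜.sets}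
    (hT : IsTower (codedOrder (DZ : Set 𝓜.Num) LZ) (T : Set 𝓜.Num) R)
    (htop : (codedOrder (DZ : Set 𝓜.Num) LZ).dom top)
    (hdom : ∀ x, X.dom x → (codedOrder (DZ : Set 𝓜.Num) LZ).dom (pair 0 x))
    (hlt_top : ∀ x, X.dom x → (codedOrder (DZ : Set 𝓜.Num) LZ).lt (pair 0 x) top)
    (hlt : ∀ x y, X.lt x y → (codedOrder (DZ : Set 𝓜.Num) LZ).lt (pair 0 x) (pair 0 y))
    (n : 𝓜.Num) :
    ∀ σ τ v w, (codedOrder (E : Set 𝓜.Num) K).dom σ → (codedOrder (E : Set 𝓜.Num) K).dom τ →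
      rel (Q : Set 𝓜.Num) n σ v → rel (Q : Set 𝓜.Num) n τ w →
      (towerLevel (T : Set 𝓜.Num) R (n + n)).dom v ∧
      (∀ z j, (codedOrder (DZ : Set 𝓜.Num) LZ).dom z → (codedOrder (DZ : Set 𝓜.Num) LZ).lt z top →
        rel (J : Set 𝓜.Num) (n + n) j z → (towerLevel (T : Set 𝓜.Num) R (n + n)).lt j v) ∧
      (∀ j, rel (J : Set 𝓜.Num) (n + n) j top →
        (towerLevel (T : Set 𝓜.Num) R (n + n)).lt j v ∨ j = v) ∧
      ((codedOrder (E : Set 𝓜.Num) K).lt σ τ → (towerLevel (T : Set 𝓜.Num) R (n + n)).lt v w) := by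
  refine pi1_induction (P := fun n => ∀ σ τ v w, (codedOrder (E : Set 𝓜.Num) K).dom σ →
      (codedOrder (E : Set 𝓜.Num) K).dom τ →
      rel (Q : Set 𝓜.Num) n σ v → rel (Q : Set 𝓜.Num) n τ w →
      (towerLevel (T : Set 𝓜.Num) R (n + n)).dom v ∧
      (∀ z j, (codedOrder (DZ : Set 𝓜.Num) LZ).dom z → (codedOrder (DZ : Set 𝓜.Num) LZ).lt z top →
        rel (J : Set 𝓜.Num) (n + n) j z → (towerLevel (T : Set 𝓜.Num) R (n + n)).lt j v) ∧
      (∀ j, rel (J : Set 𝓜.Num) (n + n) j top →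
        (towerLevel (T : Set 𝓜.Num) R (n + n)).lt j v ∨ j = v) ∧
      ((codedOrder (E : Set 𝓜.Num) K).lt σ τ → (towerLevel (T : Set 𝓜.Num) R (n + n)).lt v w))
      ?_ ?_ n
  · intro σ τ v w hσ hτ hv hw
    rcases hG.dom_cases hσ with rfl | ⟨γ, δ, ρ, rfl⟩
    swap
    · exact (hQ.zero_cons _ _ _ hv).elim
    rcases hG.dom_cases hτ with rfl | ⟨γ, δ, ρ, rfl⟩
    swap
    · exact (hQ.zero_cons _ _ _ hw).elim
    rw [hQ.nil_iff] at hv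
    refine ⟨(hJ.strictMono hT _ _ _ _ _ htop htop hv hv).1, ?_, ?_, fun h => ?_⟩
    · intro z j hz hzt hj
      exact (hJ.strictMono hT _ _ _ _ _ hz htop hj hv).2 hzt
    · intro j hj
      exact Or.inr (hJ.unique hj hv)
    · exact (hG.not_lt_nil _ h).elim
  · intro n ih
    have e2 : n + 1 + (n + 1) = n + n + 1 + 1 := by ring
    simp only [e2]
    have hS := hT.succ (n + n)
    have hS' := hT.succ (n + n + 1)
    have entry_dom : ∀ γ δ u w, (codedOrder (E : Set 𝓜.Num) K).dom γ → X.dom δ →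
        rel (Q : Set 𝓜.Num) n γ u → rel (J : Set 𝓜.Num) (n + n) w (pair 0 δ) →
        (towerLevel (T : Set 𝓜.Num) R (n + n + 1)).dom (cons u (cons w nil)) := by
      intro γ δ u w hγ hδ hu hw
      obtain ⟨h1, h2, -, -⟩ := ih γ γ u u hγ hγ hu hu
      have hδ' := hdom δ hδ
      refine hS.dom_cons_cons.2 ⟨h1, hS.dom_singleton.2 ?_, Or.inl (h2 _ _ hδ' (hlt_top δ hδ) hw)⟩
      exact (hJ.strictMono hT _ _ _ _ _ hδ' hδ' hw hw).1
    -- A tie between `u` and `j` is possible if `z` is the top element; then the length-two sequence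
    -- is larger as a proper extension.
    have entry_gt : ∀ γ δ u w z j, (codedOrder (E : Set 𝓜.Num) K).dom γ → X.dom δ →
        rel (Q : Set 𝓜.Num) n γ u → rel (J : Set 𝓜.Num) (n + n) w (pair 0 δ) →
        (codedOrder (DZ : Set 𝓜.Num) LZ).dom z →
        (codedOrder (DZ : Set 𝓜.Num) LZ).lt z top ∨ z = top → rel (J : Set 𝓜.Num) (n + n) j z →
        (towerLevel (T : Set 𝓜.Num) R (n + n + 1)).lt (cons j nil) (cons u (cons w nil)) := by
      intro γ δ u w z j hγ hδ hu hw hz hzt hj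
      have hd := entry_dom γ δ u w hγ hδ hu hw
      obtain ⟨-, h2, h3, -⟩ := ih γ γ u u hγ hγ hu hu
      refine hS.lt_cons_cons.2 ⟨hS.dom_singleton.2
        (hJ.strictMono hT _ _ _ _ _ hz hz hj hj).1, hd, ?_⟩
      have hd' := (hS.dom_cons.1 hd).2.1
      rcases hzt with hzt | rfl
      · exact Or.inl (h2 z j hz hzt hj)
      · exact (h3 j hj).imp_right fun h => ⟨h, hS.nil_lt_cons.2 hd'⟩
    have singleton : ∀ j z, rel (J : Set 𝓜.Num) (n + n + 1 + 1) j z ↔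
        ∃ i, j = cons (cons i nil) nil ∧ rel (J : Set 𝓜.Num) (n + n) i z := by
      intro j z
      rw [hJ.succ_iff]
      simp only [hJ.succ_iff]
      constructor
      · rintro ⟨_, rfl, i, rfl, h⟩
        exact ⟨i, rfl, h⟩
      · rintro ⟨i, rfl, h⟩
        exact ⟨_, rfl, i, rfl, h⟩
    have entry_lt : ∀ γ δ u w γ' δ' u' w', (codedOrder (E : Set 𝓜.Num) K).dom γ → X.dom δ →
        rel (Q : Set 𝓜.Num) n γ u → rel (J : Set 𝓜.Num) (n + n) w (pair 0 δ) →
        (codedOrder (E : Set 𝓜.Num) K).dom γ' → X.dom δ' →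
        rel (Q : Set 𝓜.Num) n γ' u' → rel (J : Set 𝓜.Num) (n + n) w' (pair 0 δ') →
        (codedOrder (E : Set 𝓜.Num) K).lt γ γ' ∨ γ = γ' ∧ X.lt δ δ' →
        (towerLevel (T : Set 𝓜.Num) R (n + n + 1)).lt (cons u (cons w nil))
          (cons u' (cons w' nil)) := by
      intro γ δ u w γ' δ' u' w' hγ hδ hu hw hγ' hδ' hu' hw' h
      have hd := entry_dom γ δ u w hγ hδ hu hw
      have hd' := entry_dom γ' δ' u' w' hγ' hδ' hu' hw'
      refine hS.lt_cons_cons.2 ⟨hd, hd', ?_⟩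
      rcases h with h | ⟨rfl, h⟩
      · exact Or.inl ((ih _ _ _ _ hγ hγ' hu hu').2.2.2 h)
      · refine Or.inr ⟨hQ.unique hJ hG hγ hu hu', hS.lt_cons_cons.2
          ⟨(hS.dom_cons.1 hd).2.1, (hS.dom_cons.1 hd').2.1, Or.inl ?_⟩⟩
        exact (hJ.strictMono hT _ _ _ _ _ (hdom δ hδ) (hdom δ' hδ') hw hw').2 (hlt _ _ h)
    have dom : ∀ σ v, (codedOrder (E : Set 𝓜.Num) K).dom σ → rel (Q : Set 𝓜.Num) (n + 1) σ v →
        (towerLevel (T : Set 𝓜.Num) R (n + n + 1 + 1)).dom v := by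
      intro σ
      refine pi1_strong_induction (P := fun σ => ∀ v, (codedOrder (E : Set 𝓜.Num) K).dom σ →
        rel (Q : Set 𝓜.Num) (n + 1) σ v →
        (towerLevel (T : Set 𝓜.Num) R (n + n + 1 + 1)).dom v) ?_ σ
      intro σ ihσ v hσ hv
      rcases hG.dom_cases hσ with rfl | ⟨γ, δ, ρ, rfl⟩
      · rw [hQ.nil_iff, e2] at hv
        exact (hJ.strictMono hT _ _ _ _ _ htop htop hv hv).1
      · obtain ⟨hγ, hδ, hρ, hh⟩ := hG.dom_cons.1 hσ
        obtain ⟨u, w, v', rfl, hu, hw, hv'⟩ := (hQ.succ_cons_iff _ _ _ _ _).1 hv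
        refine hS'.dom_cons.2 ⟨entry_dom γ δ u w hγ hδ hu hw, ihσ ρ (by simp) v' hρ hv', ?_⟩
        rintro b m rfl
        refine Or.inl ?_
        rcases hG.dom_cases hρ with rfl | ⟨γ', δ', ρ', rfl⟩
        -- After the last summand comes the image of the empty term: its only entry is the singleton
        -- of the image of the top element, which lies below every entry from a summand.
        · rw [hQ.nil_iff, e2, singleton] at hv'
          obtain ⟨i, e, hi⟩ := hv'
          rw [cons_inj] at e
          obtain ⟨rfl, rfl⟩ := e
          exact entry_gt γ δ u w top i hγ hδ hu hw htop (Or.inr rfl) hi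
        · obtain ⟨hγ', hδ', -, -⟩ := hG.dom_cons.1 hρ
          obtain ⟨u', w', v'', e, hu', hw', -⟩ := (hQ.succ_cons_iff _ _ _ _ _).1 hv'
          rw [cons_inj] at e
          obtain ⟨rfl, rfl⟩ := e
          exact entry_lt γ' δ' u' w' γ δ u w hγ' hδ' hu' hw' hγ hδ hu hw
            (Or.inl (hh _ _ _ rfl))
    have above : ∀ γ δ ρ v z j, (codedOrder (E : Set 𝓜.Num) K).dom (cons (pair γ δ) ρ) →
        rel (Q : Set 𝓜.Num) (n + 1) (cons (pair γ δ) ρ) v →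
        (codedOrder (DZ : Set 𝓜.Num) LZ).dom z →
        (codedOrder (DZ : Set 𝓜.Num) LZ).lt z top ∨ z = top →
        rel (J : Set 𝓜.Num) (n + n + 1 + 1) j z →
        (towerLevel (T : Set 𝓜.Num) R (n + n + 1 + 1)).lt j v := by
      intro γ δ ρ v z j hσ hv hz hzt hj
      have dv := dom _ _ hσ hv
      have dj := (hJ.strictMono hT _ _ _ _ _ hz hz hj hj).1
      obtain ⟨hγ, hδ, -, -⟩ := hG.dom_cons.1 hσ
      obtain ⟨u, w, v', rfl, hu, hw, -⟩ := (hQ.succ_cons_iff _ _ _ _ _).1 hv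
      obtain ⟨i, rfl, hi⟩ := (singleton _ _).1 hj
      exact hS'.lt_cons_cons.2 ⟨dj, dv, Or.inl (entry_gt γ δ u w z i hγ hδ hu hw hz hzt hi)⟩
    intro σ τ v w hσ hτ hv hw
    refine ⟨dom σ v hσ hv, ?_, ?_, ?_⟩
    · intro z j hz hzt hj
      rcases hG.dom_cases hσ with rfl | ⟨γ, δ, ρ, rfl⟩
      · rw [hQ.nil_iff, e2] at hv
        exact (hJ.strictMono hT _ _ _ _ _ hz htop hj hv).2 hzt
      · exact above γ δ ρ v z j hσ hv hz (Or.inl hzt) hj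
    · intro j hj
      rcases hG.dom_cases hσ with rfl | ⟨γ, δ, ρ, rfl⟩
      · rw [hQ.nil_iff, e2] at hv
        exact Or.inr (hJ.unique hj hv)
      · exact Or.inl (above γ δ ρ v top j hσ hv htop (Or.inr rfl) hj)
    · refine pi1_strong_induction (P := fun σ => ∀ τ v w, (codedOrder (E : Set 𝓜.Num) K).dom σ →
        (codedOrder (E : Set 𝓜.Num) K).dom τ → rel (Q : Set 𝓜.Num) (n + 1) σ v →
        rel (Q : Set 𝓜.Num) (n + 1) τ w → (codedOrder (E : Set 𝓜.Num) K).lt σ τ →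
        (towerLevel (T : Set 𝓜.Num) R (n + n + 1 + 1)).lt v w) ?_ σ τ v w hσ hτ hv hw
      clear hσ hτ hv hw σ τ v w
      intro σ ihσ τ v w hσ hτ hv hw hlt'
      rcases hG.dom_cases hτ with rfl | ⟨γ', δ', ρ', rfl⟩
      · exact (hG.not_lt_nil _ hlt').elim
      rcases hG.dom_cases hσ with rfl | ⟨γ, δ, ρ, rfl⟩
      · rw [hQ.nil_iff, e2] at hv
        exact above γ' δ' ρ' w top v hτ hw htop (Or.inr rfl) hv
      have dv := dom _ _ hσ hv
      have dw := dom _ _ hτ hw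
      obtain ⟨hγ, hδ, hρ, -⟩ := hG.dom_cons.1 hσ
      obtain ⟨hγ', hδ', hρ', -⟩ := hG.dom_cons.1 hτ
      obtain ⟨u, x, v', rfl, hu, hx, hv'⟩ := (hQ.succ_cons_iff _ _ _ _ _).1 hv
      obtain ⟨u', x', w', rfl, hu', hx', hw'⟩ := (hQ.succ_cons_iff _ _ _ _ _).1 hw
      refine hS'.lt_cons_cons.2 ⟨dv, dw, ?_⟩
      rcases (hG.lt_cons_cons.1 hlt').2.2 with h | ⟨rfl, h | ⟨rfl, h⟩⟩
      · exact Or.inl (entry_lt γ δ u x γ' δ' u' x' hγ hδ hu hx hγ' hδ' hu' hx' (Or.inl h))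
      · exact Or.inl (entry_lt γ δ u x γ δ' u' x' hγ hδ hu hx hγ' hδ' hu' hx' (Or.inr ⟨rfl, h⟩))
      -- Equal leading summands have equal images, since the maps are single-valued.
      · refine Or.inr ⟨?_, ihσ ρ (by simp) ρ' v' w' hρ hρ' hv' hw' h⟩
        rw [hQ.unique hJ hG hγ hu hu', hJ.unique hx hx']

end IsTermMap

theorem goodsteinIsDilator_of_acaPrime (h : 𝓜.ACAPrime) : 𝓜.GoodsteinIsDilator := by
  intro D hD L hL hX
  lift D to 𝓜.sets using hD
  lift L to 𝓜.sets using hL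
  refine ⟨?_, ?_⟩
  · obtain ⟨E, K, hG⟩ := exists_isGoodstein D L
    exact ⟨E, E.2, K, K.2, hG⟩
  · intro E hE K hK hG
    lift E to 𝓜.sets using hE
    lift K to 𝓜.sets using hK
    have hlin := hG.isLinear hX.1
    refine ⟨hlin, ?_⟩
    obtain ⟨D₁, L₁, h₁, h₁dom⟩ := exists_one (𝓜 := 𝓜)
    obtain ⟨DZ, LZ, hZ⟩ := exists_isSum D L D₁ L₁
    obtain ⟨⟨T, hTs, R, hRs, hT⟩, hwf⟩ := h DZ DZ.2 LZ LZ.2 (hZ.isWellOrder hX h₁)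
    replace hwf := hwf T hTs R hRs hT
    lift T to 𝓜.sets using hTs
    lift R to 𝓜.sets using hRs
    obtain ⟨J, hJ⟩ := exists_isSingletonMap (𝓜 := 𝓜)
    obtain ⟨H, hH⟩ := exists_isHeight (𝓜 := 𝓜)
    obtain ⟨Q, hQ⟩ := exists_isTermMap J (pair 1 0)
    have h0 := (h₁dom 0).2 rfl
    rintro ⟨F, hF, tot, dom, desc⟩
    lift F to 𝓜.sets using hF
    -- The code `n` of the first term bounds its height, and hence that of all later terms, so the
    -- sequence is mapped into the single level `n + n`.
    obtain ⟨n, hn, hn'⟩ := tot 0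
    have height : ∀ i, ∀ σ, pair i σ ∈ (F : Set 𝓜.Num) → pair n σ ∈ (H : Set 𝓜.Num) := by
      intro i
      refine pi1_induction (P := fun i => ∀ σ, pair i σ ∈ (F : Set 𝓜.Num) →
        pair n σ ∈ (H : Set 𝓜.Num)) ?_ ?_ i
      · intro σ hσ
        obtain rfl := hn' σ hσ
        exact hH.mem_of_le hG le_rfl (dom 0 _ hn)
      · intro i ih τ hτ
        obtain ⟨σ, hσ, -⟩ := tot i
        exact hH.mem_of_lt hG hlin (desc i σ τ hσ hτ) (ih σ hσ)
    have mono := hQ.strictMono hJ hG hT (hZ.dom_right.2 h0) (fun x hx => hZ.dom_left.2 hx)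
      (fun x hx => hZ.lt_left_right.2 ⟨hx, h0⟩) (fun x y hxy => hZ.lt_left.2 hxy) n
    refine (hwf (n + n)).false_of_descending
      (fun i v => ∃ σ, pair i σ ∈ (F : Set 𝓜.Num) ∧ rel (Q : Set 𝓜.Num) n σ v) ?_ ?_ ?_ ?_
    · intro i
      obtain ⟨σ, hσ, -⟩ := tot i
      obtain ⟨v, hv⟩ := hQ.total hJ hG hH (dom i σ hσ) (height i σ hσ)
      exact ⟨v, σ, hσ, hv⟩
    · rintro i v v' ⟨σ, hσ, hv⟩ ⟨σ', hσ', hv'⟩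
      obtain rfl := (tot i).unique hσ hσ'
      exact hQ.unique hJ hG (dom i σ hσ) hv hv'
    · rintro i v ⟨σ, hσ, hv⟩
      exact (mono σ σ v v (dom i σ hσ) (dom i σ hσ) hv hv).1
    · rintro i v w ⟨σ, hσ, hv⟩ ⟨τ, hτ, hw⟩
      exact (mono τ σ w v (dom _ τ hτ) (dom i σ hσ) hw hv).2.2.2 (desc i σ τ hσ hτ)

end GoodsteinToTower

end SOA

/-! ### The equivalence -/

theorem proposition5p4 (𝓜 : SOA.L2Structure.{u}) (h𝓜 : 𝓜.IsModelRCA0) :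
    𝓜.ACAPrime ↔ 𝓜.GoodsteinIsDilator := by
  have : Fact 𝓜.IsModelRCA0 := ⟨h𝓜⟩
  exact ⟨SOA.goodsteinIsDilator_of_acaPrime, SOA.acaPrime_of_goodsteinIsDilator⟩
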